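/- Let $F$ be a field of characteristic $0$, let $D$ be a finite-dimensional central division algebra over $F$ with $\dim_F D=d^2$, and let $p,q,p',q'\ge 0$ be integers with $p+q=p'+q'=N$. Let $V=D^N$ be regarded as a right $D$-module, let $G=GL_D(V)=GL_{N,D}$ be viewed as an algebraic group over $F$, and for $0\le r\le N$ put $\theta_r=\mathrm{diag}(I_r,-I_{N-r})\in G(F)$. Put $\theta=\theta_p$, let $G^\theta\simeq GL_{p,D}\times GL_{q,D}$ be its centralizer in $G$, and let $$S_{p'}=\{g\,\theta_{p'}\,g^{-1}\theta \mid g\in G\},$$ a connected component of the variety $S=\{g\in G\mid (g\theta)^2=1\}$, on which $G^\theta$ acts by conjugation. Put $\nu=\min\{p,q,p',q'\}$. For a geometric point $x$ of $S_{p'}$, let $x^+$ be the upper left $p\times p$ block of $x$ (its component in $\mathrm{End}_D(V^+)$, where $V^+=\ker(\theta-1)$), let $\mathrm{Prd}_{x^+}(t)$ be the reduced characteristic polynomial of $x^+$, and put $$\chi_x=(t-1)^{-d\max\{p'-q,0\}}\,(t+1)^{-d\max\{p-p',0\}}\,\mathrm{Prd}_{x^+}(t).$$ Then $\chi_x$ is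 a monic polynomial of degree $d\nu$. The map that sends $x$ to the $d\nu$ non-leading coefficients of $\chi_x$ is a morphism $c^\flat:S_{p'}\to\mathbf{A}^{d\nu}$ of varieties over $F$, and $(c^\flat,\mathbf{A}^{d\nu})$ is a categorical quotient of $S_{p'}$ by $G^\theta$. That is, the comorphism of $c^\flat$ is an isomorphism of $F[\mathbf{A}^{d\nu}]$ onto the algebra $F[S_{p'}]^{G^\theta}$ of $G^\theta$-invariant regular functions; equivalently, $c^\flat$ is $G^\theta$-invariant, and every $G^\theta$-invariant morphism from $S_{p'}$ to an affine $F$-scheme factors uniquely through $c^\flat$. In particular, $F[S_{p'}]^{G^\theta}$ is a polynomial ring over $F$ in $d\nu$ variables, namely the coefficients of $\chi_x$. -/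

import Mathlib

open scoped TensorProduct Polynomial

/-!
Throughout, `F` is the base field, `D` a central division algebra over `F`, `K` an algebraic closure
of `F`, and varieties over `F` are described by their geometric points (points over `K`) together
with their `F`-algebra of regular functions.  After the choice of a basis adapted to the involution,
`V = D ^ (p + q)`, the group `G = GL_D(V)` has geometric points `GLPoints F D K (p + q)`, and the
involution is the diagonal matrix `signUnit (p + q) p`, with `p` entries `1` and `q` entries `-1`.
-/

universe w

namespace SymSpace

/-- The diagonal matrix `diag(1, …, 1, -1, …, -1)` of size `n` whose first `r` diagonal entries are
`1` and whose other diagonal entries are `-1`, as an invertible matrix. -/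
def signUnit {A : Type*} [Ring A] (n r : ℕ) : (Matrix (Fin n) (Fin n) A)ˣ where
  val := Matrix.diagonal fun i => if i.val < r then 1 else -1
  inv := Matrix.diagonal fun i => if i.val < r then 1 else -1
  val_inv := by
    rw [Matrix.diagonal_mul_diagonal, ← Matrix.diagonal_one]
    congr 1; funext i; split_ifs <;> simp
  inv_val := by
    rw [Matrix.diagonal_mul_diagonal, ← Matrix.diagonal_one]
    congr 1; funext i; split_ifs <;> simp

/-- The reduced characteristic polynomial of an element `a` of a split central simple algebra `A`
over `K`: the characteristic polynomial of the image of `a` under an isomorphism of `A` with a matrix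
algebra over `K` (it does not depend on the isomorphism).  All finite-dimensional central simple
algebras over an algebraically closed field are split.  The zero algebra counts as the algebra of
matrices of size `0`; there the polynomial is `1`. -/
noncomputable def reducedCharpoly (K : Type*) [Field K] {A : Type*} [Ring A] [Algebra K A] (a : A) :
    K[X] :=
  open Classical in
  if h : ∃ n : ℕ, Nonempty (A ≃ₐ[K] Matrix (Fin n) (Fin n) K) then
    (h.choose_spec.some a).charpoly
  else 0

section

variable (F : Type*) [Field F] (D : Type*) [DivisionRing D] [Algebra F D]
  (K : Type*) [Field K] [Algebra F K]

/-- The geometric points of the algebraic group `GL_{n,D}` over `F`. -/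
abbrev GLPoints (n : ℕ) : Type _ := (Matrix (Fin n) (Fin n) (K ⊗[F] D))ˣ

variable {F D}

/-- The `K`-linear extension `K ⊗ D → K` of an `F`-linear form on `D`. -/
noncomputable def extendForm (l : D →ₗ[F] F) : K ⊗[F] D →ₗ[K] K :=
  (TensorProduct.AlgebraTensorModule.rid F K K).toLinearMap ∘ₗ l.baseChange K

variable (F D) {K}

/-- For the set `X` of geometric points of a Zariski closed subvariety of `GL_{n,D}` defined over
`F`: the `F`-algebra `F[X]` of regular functions on it.  These are the restrictions to `X` of the
polynomials with coefficients in `F` in the coordinates of `g` and of `g⁻¹`; the coordinates are the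
values of the `F`-linear forms on `D` at the matrix entries. -/
noncomputable def regularFunctions {n : ℕ} (X : Set (GLPoints F D K n)) : Subalgebra F (X → K) :=
  Algebra.adjoin F
    ({f | ∃ (l : D →ₗ[F] F) (i j : Fin n), f = fun g => extendForm K l (g.1.val i j)} ∪
      {f | ∃ (l : D →ₗ[F] F) (i j : Fin n), f = fun g => extendForm K l (g.1⁻¹.val i j)})

variable (K)

/-- The geometric points of the centralizer `G^θ` of `θ = diag(1_p, -1_q)` in `G = GL_{p+q,D}`. -/
noncomputable def centralizerTheta (p q : ℕ) : Subgroup (GLPoints F D K (p + q)) :=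
  Subgroup.centralizer {signUnit (p + q) p}

/-- The geometric points of the component `S_{p'}` of `S = {g ∈ G | (g θ)² = 1}`: the elements
`g θ_{p'} g⁻¹ θ` for `g ∈ G`. -/
def component (p q p' : ℕ) : Set (GLPoints F D K (p + q)) :=
  {x | ∃ g : GLPoints F D K (p + q), x = g * signUnit (p + q) p' * g⁻¹ * signUnit (p + q) p}

variable {F D K}

/-- The action of `G^θ` on `S_{p'}` by conjugation. -/
def conj {p q p' : ℕ} (h : centralizerTheta F D K p q) (x : component F D K p q p') :
    component F D K p q p' :=
  ⟨h.1 * x.1 * h.1⁻¹, by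
    obtain ⟨h, hh⟩ := h
    obtain ⟨_, g, rfl⟩ := x
    have hc : signUnit (p + q) p * h = h * signUnit (p + q) p :=
      Subgroup.mem_centralizer_iff.1 hh _ rfl
    have hc' : signUnit (p + q) p * h⁻¹ = h⁻¹ * signUnit (p + q) p := by
      rw [mul_inv_eq_iff_eq_mul, mul_assoc, hc, inv_mul_cancel_left]
    refine ⟨h * g, ?_⟩
    simp only [mul_assoc, mul_inv_rev]
    rw [hc']⟩

variable (F D K)

/-- The algebra `F[S_{p'}]^{G^θ}` of the regular functions on `S_{p'}` that are invariant
under `G^θ`. -/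
noncomputable def invariants (p q p' : ℕ) :
    Subalgebra F (regularFunctions F D (component F D K p q p')) where
  carrier := {f | ∀ (h : centralizerTheta F D K p q) (x : component F D K p q p'),
    f.1 (conj h x) = f.1 x}
  mul_mem' := fun ha hb h x => congrArg₂ (· * ·) (ha h x) (hb h x)
  add_mem' := fun ha hb h x => congrArg₂ (· + ·) (ha h x) (hb h x)
  algebraMap_mem' := fun _ _ _ => rfl

/-- Let `Y` be the affine `F`-scheme `Spec R`, and let `c : S_{p'} → Y` be the morphism with
comorphism `R → F[S_{p'}]`.  The pair `(c, Y)` is a categorical quotient of `S_{p'}` by `G^θ`, in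
affine `F`-schemes: `c` is `G^θ`-invariant, and every `G^θ`-invariant morphism `S_{p'} → Spec B`
factors uniquely through `c`. -/
def IsCategoricalQuotient (p q p' : ℕ) {R : Type*} [CommRing R] [Algebra F R]
    (c : R →ₐ[F] regularFunctions F D (component F D K p q p')) : Prop :=
  (∀ r, c r ∈ invariants F D K p q p') ∧
    ∀ (B : Type w) [CommRing B] [Algebra F B]
      (φ : B →ₐ[F] regularFunctions F D (component F D K p q p')),
      (∀ b, φ b ∈ invariants F D K p q p') → ∃! ψ : B →ₐ[F] R, c.comp ψ = φ

variable {F D K}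

/-- The component `x⁺` of `x` in `End_D(V⁺)`, i.e. its upper left block of size `p`. -/
def plusBlock {p q : ℕ} (x : GLPoints F D K (p + q)) : Matrix (Fin p) (Fin p) (K ⊗[F] D) :=
  x.val.submatrix (Fin.castAdd q) (Fin.castAdd q)

variable (K) in
/-- The polynomial `(t - 1) ^ (d max(p' - q, 0)) (t + 1) ^ (d max(p - p', 0))`
(subtraction of natural numbers is truncated at `0`). -/
noncomputable def divisor (d p q p' : ℕ) : K[X] :=
  (Polynomial.X - 1) ^ (d * (p' - q)) * (Polynomial.X + 1) ^ (d * (p - p'))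

/-- The polynomial `χ_x`: the quotient of the reduced characteristic polynomial of `x⁺` by the
monic polynomial `divisor`. -/
noncomputable def chi (d p q p' : ℕ) (x : component F D K p q p') : K[X] :=
  reducedCharpoly K (plusBlock x.1) /ₘ divisor K d p q p'

end

end SymSpace

namespace SymSpace

open Module Matrix

/-! Over `K` the algebra `K ⊗ D` splits, and `x ↦ x θ` turns `S_{p'}` into a conjugacy class of
involutions `s = (a b; c e)` with diagonal blocks of sizes `d p` and `d q`. The group `G^θ` becomes
the block diagonal group, and `a` is the image of `x⁺`. By a dimension count, `s` has eigenvectors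
for `1` and `-1` inside the first block; they account for the factor of the characteristic
polynomial of `a` that is divided out in `χ` (`dvd_charpoly`).

The matrix `(a, 1 - a²; 1, -a)`, enlarged by signs, is such an involution, and its `χ` is the
characteristic polynomial of `a`. Taking companion matrices for `a` gives a section of `c♭`
(`blockChi_companionSlice`), so `c♭` is surjective on geometric points and its comorphism is
injective.

Conversely, suppose that the roots `x i` of `χ_s` are distinct and different from `1` and `-1`.
Eigenvectors `v i` of `a`, their images `c v i`, and the eigenvectors for `1` and `-1` inside the
two blocks form bases of the blocks in which `s` is the slice of `diag(x i)`
(`exists_conj_slice_diagonal`). Thus `χ_s` determines the orbit of `s`, and an invariant `f` equals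
`P(χ)` there, where `P` is the restriction of `f` to the companion section. The condition on the
roots is the nonvanishing of a discriminant, and the conjugacy class is irreducible, being an orbit
of `GL`; so `f = P(χ)` everywhere (`eval_eq_zero_of_conj`, `exists_eval_blockChi_coeff`).

It remains to descend from `K` to `F`. The polynomial `χ` is Galois equivariant because reduced
characteristic polynomials do not depend on the splitting (`chi_galComponent`). Averaging over
Galois conjugates shows that its coefficients are regular over `F`
(`mem_of_mem_adjoin_of_equivariant`). If `f` is defined over `F`, then surjectivity of `c♭` forces
`P` to be Galois invariant, hence to have coefficients in `F`. The universal property is then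
formal. -/

lemma toLin'_mul_self_eq_one {K m : Type*} [Field K] [Fintype m] [DecidableEq m]
    {s : Matrix m m K} (hs : s * s = 1) : toLin' s * toLin' s = 1 := by
  rw [Module.End.mul_eq_comp, ← toLin'_mul, hs, toLin'_one]; rfl

lemma charpoly_toLin' {K m : Type*} [Field K] [Fintype m] [DecidableEq m] (a : Matrix m m K) :
    (toLin' a).charpoly = a.charpoly := by
  rw [← LinearMap.charpoly_toMatrix (toLin' a) (Pi.basisFun K _), ← toLin_eq_toLin',
    LinearMap.toMatrix_toLin]

lemma trace_fromBlocks {R I J : Type*} [CommRing R] [Fintype I] [Fintype J] (a : Matrix I I R)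
    (b : Matrix I J R) (c : Matrix J I R) (e : Matrix J J R) :
    (fromBlocks a b c e).trace = a.trace + e.trace := by
  simp [trace]

lemma eigenspace_neg {K V : Type*} [Field K] [AddCommGroup V] [Module K V] (T : End K V) (μ : K) :
    (-T).eigenspace μ = T.eigenspace (-μ) := by
  ext x
  rw [End.mem_eigenspace_iff, End.mem_eigenspace_iff, LinearMap.neg_apply, neg_smul,
    neg_eq_iff_eq_neg]

/-! ### Involutions: eigenspaces, traces and conjugacy -/

section Involution

variable {K : Type*} [Field K] [CharZero K] {V : Type*} [AddCommGroup V] [Module K V]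

lemma isCompl_eigenspace_one_neg_one {T : End K V} (hT : T * T = 1) :
    IsCompl (T.eigenspace 1) (T.eigenspace (-1)) := by
  refine ⟨?_, ?_⟩
  · rw [Submodule.disjoint_def]
    intro x h1 h2
    rw [End.mem_eigenspace_iff] at h1 h2
    rw [h1, one_smul, neg_smul, one_smul] at h2
    have : (2 : K) • x = 0 := by rw [two_smul]; nth_rw 2 [h2]; simp
    simpa using this
  · rw [codisjoint_iff, eq_top_iff]
    intro x _
    have hx : T (T x) = x := by rw [← Module.End.mul_apply, hT]; rfl
    rw [Submodule.mem_sup]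
    refine ⟨(2⁻¹ : K) • (x + T x), ?_, (2⁻¹ : K) • (x - T x), ?_, ?_⟩
    · rw [End.mem_eigenspace_iff]; simp [hx, add_comm]
    · rw [End.mem_eigenspace_iff]; simp [hx, ← smul_neg]
    · rw [← smul_add, add_add_sub_cancel, ← two_smul K x, smul_smul]; simp

variable [FiniteDimensional K V]

/-- The dimension of the fixed space of an involution in terms of its trace. -/
lemma two_mul_finrank_eigenspace_one {T : End K V} (hT : T * T = 1) :
    2 * (finrank K (T.eigenspace 1) : K) = finrank K V + LinearMap.trace K V T := by
  -- The trace of the projector `(1 + T) / 2` is its rank.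
  have hp : LinearMap.IsProj (T.eigenspace 1) ((2⁻¹ : K) • (1 + T)) := by
    refine ⟨fun x => ?_, fun x hx => ?_⟩
    · rw [End.mem_eigenspace_iff]
      have : T (T x) = x := by rw [← Module.End.mul_apply, hT]; rfl
      simp [this, add_comm]
    · rw [End.mem_eigenspace_iff, one_smul] at hx
      rw [LinearMap.smul_apply, LinearMap.add_apply, End.one_apply, hx, ← two_smul K x, smul_smul,
        inv_mul_cancel₀ two_ne_zero, one_smul]
  have := hp.trace
  rw [map_smul, map_add, LinearMap.trace_one, smul_eq_mul] at this
  rw [← this]; field_simp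

lemma two_mul_finrank_eigenspace_neg_one {T : End K V} (hT : T * T = 1) :
    2 * (finrank K (T.eigenspace (-1)) : K) = finrank K V - LinearMap.trace K V T := by
  have := two_mul_finrank_eigenspace_one (T := -T) (by simpa using hT)
  rw [eigenspace_neg] at this
  rw [this, map_neg, sub_eq_add_neg]

/-- Two involutions with the same trace are conjugate. -/
lemma exists_linearEquiv_conj {S T : End K V} (hS : S * S = 1) (hT : T * T = 1)
    (h : LinearMap.trace K V S = LinearMap.trace K V T) :
    ∃ g : V ≃ₗ[K] V, ∀ x, g (T x) = S (g x) := by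
  have d1 : finrank K (T.eigenspace 1) = finrank K (S.eigenspace 1) := by
    have h1 := two_mul_finrank_eigenspace_one hS
    have h2 := two_mul_finrank_eigenspace_one hT
    rw [h, ← h2] at h1
    exact_mod_cast (mul_left_cancel₀ two_ne_zero h1).symm
  have d2 : finrank K (T.eigenspace (-1)) = finrank K (S.eigenspace (-1)) := by
    have h1 := two_mul_finrank_eigenspace_neg_one hS
    have h2 := two_mul_finrank_eigenspace_neg_one hT
    rw [h, ← h2] at h1
    exact_mod_cast (mul_left_cancel₀ two_ne_zero h1).symm
  let e1 := LinearEquiv.ofFinrankEq _ _ d1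
  let e2 := LinearEquiv.ofFinrankEq _ _ d2
  let iT := Submodule.prodEquivOfIsCompl _ _ (isCompl_eigenspace_one_neg_one hT)
  let iS := Submodule.prodEquivOfIsCompl _ _ (isCompl_eigenspace_one_neg_one hS)
  refine ⟨iT.symm ≪≫ₗ (e1.prodCongr e2) ≪≫ₗ iS, fun x => ?_⟩
  obtain ⟨⟨u, v⟩, rfl⟩ := iT.surjective x
  have hu : T u = u := by simpa using End.mem_eigenspace_iff.1 u.2
  have hv : T v = -v := by simpa using End.mem_eigenspace_iff.1 v.2
  have hu' : S (e1 u) = e1 u := by simpa using End.mem_eigenspace_iff.1 (e1 u).2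
  have hv' : S (e2 v) = -e2 v := by simpa using End.mem_eigenspace_iff.1 (e2 v).2
  have key : T (iT (u, v)) = iT (u, -v) := by simp [iT, hu, hv]
  rw [key]
  simp [iS, hu', hv']

lemma exists_units_conj {m : Type*} [Fintype m] [DecidableEq m] {s t : Matrix m m K}
    (hs : s * s = 1) (ht : t * t = 1) (h : s.trace = t.trace) :
    ∃ g : (Matrix m m K)ˣ, s = g.val * t * g⁻¹.val := by
  obtain ⟨g, hg⟩ := exists_linearEquiv_conj (K := K) (S := toLin' s) (T := toLin' t)
    (toLin'_mul_self_eq_one hs)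
    (toLin'_mul_self_eq_one ht)
    (by simpa [Matrix.trace_toLin'_eq] using h)
  have h1 : LinearMap.toMatrix' (g : (m → K) →ₗ[K] (m → K)) *
      LinearMap.toMatrix' (g.symm : (m → K) →ₗ[K] (m → K)) = 1 := by
    rw [← LinearMap.toMatrix'_comp]; simp
  have h2 : LinearMap.toMatrix' (g.symm : (m → K) →ₗ[K] (m → K)) *
      LinearMap.toMatrix' (g : (m → K) →ₗ[K] (m → K)) = 1 := by
    rw [← LinearMap.toMatrix'_comp]; simp
  refine ⟨⟨_, _, h1, h2⟩, ?_⟩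
  have h3 : LinearMap.toMatrix' (g : (m → K) →ₗ[K] (m → K)) * t =
      s * LinearMap.toMatrix' (g : (m → K) →ₗ[K] (m → K)) := by
    conv_lhs => rw [← LinearMap.toMatrix'_toLin' t]
    conv_rhs => rw [← LinearMap.toMatrix'_toLin' s]
    rw [← LinearMap.toMatrix'_comp, ← LinearMap.toMatrix'_comp]
    congr 1
    ext1 x
    exact LinearMap.ext fun _ => hg _
  simp only [Units.inv_mk]
  rw [h3, mul_assoc, h1, mul_one]

end Involution

/-- Eigenvectors are linearly independent if those with the same eigenvalue are. -/
lemma linearIndependent_of_eigenvectors {K V α : Type*} [Field K] [AddCommGroup V] [Module K V]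
    [Fintype α] (T : End K V) (v : α → V) (μ : α → K) (hv : ∀ i, T (v i) = μ i • v i)
    (h : ∀ (g : α → K) (x : K), (∀ i, μ i ≠ x → g i = 0) → ∑ i, g i • v i = 0 → ∀ i, g i = 0) :
    LinearIndependent K v := by
  classical
  rw [Fintype.linearIndependent_iff]
  intro g hg i
  have ind := (iSupIndep_iff_finsetSum_eq_zero_imp_eq_zero (T.eigenspace)).1
    T.eigenspaces_iSupIndep (Finset.univ.image μ)
    (fun x => ∑ i with μ i = x, g i • v i)
    (fun x _ => Submodule.sum_mem _ fun j hj => Submodule.smul_mem _ _ (by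
      rw [End.mem_eigenspace_iff, hv, (Finset.mem_filter.1 hj).2]))
    (by rw [← hg]; exact Finset.sum_fiberwise_of_maps_to (fun j _ => by simp) _)
    (μ i) (by simp)
  have := h (fun j => if μ j = μ i then g j else 0) (μ i) (fun j hj => by simp [hj])
    (by simpa [Finset.sum_filter, ite_smul] using ind) i
  simpa using this

/-! ### Eigenvectors of a block matrix that lie in the first block -/

section Block

variable {K : Type*} [Field K] {I J : Type*} [Fintype I] [Fintype J] [DecidableEq I]
  [DecidableEq J]

/-- Projecting the eigenspace to the `J`-coordinates loses at most `card J` dimensions. The kernel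
consists of the eigenvectors supported on `I`, which are the eigenvectors of `a` killed by `c`. -/
lemma finrank_eigenspace_fromBlocks_le (a : Matrix I I K) (b : Matrix I J K) (c : Matrix J I K)
    (e : Matrix J J K) (μ : K) :
    finrank K (End.eigenspace (toLin' (fromBlocks a b c e)) μ) ≤
      Fintype.card J + finrank K
        (End.eigenspace (toLin' a) μ ⊓ LinearMap.ker (toLin' c) : Submodule K (I → K)) := by
  let E := End.eigenspace (toLin' (fromBlocks a b c e)) μ
  let π : E →ₗ[K] (J → K) := (LinearMap.funLeft K K Sum.inr) ∘ₗ E.subtype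
  let ρ : LinearMap.ker π →ₗ[K] (I → K) :=
    (LinearMap.funLeft K K Sum.inl) ∘ₗ E.subtype ∘ₗ (LinearMap.ker π).subtype
  have key : ∀ x : LinearMap.ker π, (x.1.1 : I ⊕ J → K) = Sum.elim (ρ x) 0 := fun x => by
    have := x.2
    rw [LinearMap.mem_ker] at this
    ext (i | j)
    · rfl
    · exact congrFun this j
  have hρ : ∀ x, ρ x ∈ (End.eigenspace (toLin' a) μ ⊓ LinearMap.ker (toLin' c) :
      Submodule K (I → K)) := fun x => by
    have hx := End.mem_eigenspace_iff.1 x.1.2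
    rw [key, toLin'_apply, fromBlocks_mulVec] at hx
    refine ⟨?_, ?_⟩
    · rw [SetLike.mem_coe, End.mem_eigenspace_iff, toLin'_apply]
      ext i; simpa using congrFun hx (Sum.inl i)
    · rw [SetLike.mem_coe, LinearMap.mem_ker, toLin'_apply]
      ext j; simpa using congrFun hx (Sum.inr j)
  have hinj : Function.Injective (ρ.codRestrict _ hρ) := fun x y hxy => by
    have : ρ x = ρ y := congrArg Subtype.val hxy
    apply Subtype.ext; apply Subtype.ext
    rw [key x, key y, this]
  have h1 := LinearMap.finrank_le_finrank_of_injective hinj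
  have h2 := LinearMap.finrank_range_add_finrank_ker π
  have h3 : finrank K (LinearMap.range π) ≤ Fintype.card J := by
    simpa using Submodule.finrank_le (LinearMap.range π)
  change finrank K E ≤ _
  omega

variable [CharZero K]

/-- The hypothesis `hr` says, through the trace formula, that the fixed space of the involution has
dimension `r + card J`. -/
lemma le_finrank_eigenspace_one_inf_ker {a : Matrix I I K} {b : Matrix I J K} {c : Matrix J I K}
    {e : Matrix J J K} (hs : fromBlocks a b c e * fromBlocks a b c e = 1) {r : ℕ}
    (hr : 2 * ((r : K) + Fintype.card J) = Fintype.card I + Fintype.card J + (a.trace + e.trace)) :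
    r ≤ finrank K
        (End.eigenspace (toLin' a) 1 ⊓ LinearMap.ker (toLin' c) : Submodule K (I → K)) := by
  have h1 := finrank_eigenspace_fromBlocks_le a b c e 1
  have h2 := two_mul_finrank_eigenspace_one (K := K) (T := toLin' (fromBlocks a b c e))
    (toLin'_mul_self_eq_one hs)
  rw [trace_toLin'_eq, trace_fromBlocks, finrank_fintype_fun_eq_card, Fintype.card_sum,
    Nat.cast_add, ← hr] at h2
  have h3 := mul_left_cancel₀ two_ne_zero h2
  norm_cast at h3
  omega

lemma le_finrank_eigenspace_neg_one_inf_ker {a : Matrix I I K} {b : Matrix I J K}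
    {c : Matrix J I K} {e : Matrix J J K}
    (hs : fromBlocks a b c e * fromBlocks a b c e = 1) {r : ℕ}
    (hr : 2 * ((r : K) + Fintype.card J) = Fintype.card I + Fintype.card J - (a.trace + e.trace)) :
    r ≤ finrank K
        (End.eigenspace (toLin' a) (-1) ⊓ LinearMap.ker (toLin' c) : Submodule K (I → K)) := by
  have h1 := finrank_eigenspace_fromBlocks_le a b c e (-1)
  have h2 := two_mul_finrank_eigenspace_neg_one (K := K) (T := toLin' (fromBlocks a b c e))
    (toLin'_mul_self_eq_one hs)
  rw [trace_toLin'_eq, trace_fromBlocks, finrank_fintype_fun_eq_card, Fintype.card_sum,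
    Nat.cast_add, ← hr] at h2
  have h3 := mul_left_cancel₀ two_ne_zero h2
  norm_cast at h3
  omega

end Block

/-- The index set of the bases that consist of three groups of vectors. -/
abbrev Idx (n p m : ℕ) : Type := Fin n ⊕ (Fin p ⊕ Fin m)

/-! ### The slice of involutions -/

section Slice

variable {R : Type*} [CommRing R] {n p₁ m₁ p₂ m₂ : ℕ}

/-- The diagonal matrix with `p` entries `1` and `m` entries `-1`. -/
def signMatrix (R : Type*) [CommRing R] (p m : ℕ) : Matrix (Fin p ⊕ Fin m) (Fin p ⊕ Fin m) R :=
  diagonal (Sum.elim 1 (-1))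

lemma signMatrix_mul_self (p m : ℕ) : signMatrix R p m * signMatrix R p m = 1 := by
  rw [signMatrix, diagonal_mul_diagonal, ← diagonal_one]
  congr 1; ext (i | i) <;> simp

lemma trace_signMatrix (p m : ℕ) : (signMatrix R p m).trace = p - m := by
  simp [signMatrix, trace_diagonal, sub_eq_add_neg]

lemma signMatrix_map {S : Type*} [CommRing S] (f : R →+* S) (p m : ℕ) :
    (signMatrix R p m).map f = signMatrix S p m := by
  rw [signMatrix, diagonal_map (map_zero f), signMatrix]
  congr 1; ext (i | i) <;> simp

variable (p₁ m₁ p₂ m₂) in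
/-- A family of involutions parametrized by the square matrices of size `n`; the parameter is the
part of the upper left block that varies. -/
def slice (a : Matrix (Fin n) (Fin n) R) :
    Matrix (Idx n p₁ m₁ ⊕ Idx n p₂ m₂) (Idx n p₁ m₁ ⊕ Idx n p₂ m₂) R :=
  fromBlocks (fromBlocks a 0 0 (signMatrix R p₁ m₁)) (fromBlocks (1 - a * a) 0 0 0)
    (fromBlocks 1 0 0 0) (fromBlocks (-a) 0 0 (signMatrix R p₂ m₂))

lemma slice_mul_self (a : Matrix (Fin n) (Fin n) R) :
    slice p₁ m₁ p₂ m₂ a * slice p₁ m₁ p₂ m₂ a = 1 := by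
  simp only [slice, fromBlocks_multiply, fromBlocks_add, signMatrix_mul_self]
  have h' : a * (1 - a * a) + -((1 - a * a) * a) = 0 := by noncomm_ring
  simp [h']

lemma trace_slice (a : Matrix (Fin n) (Fin n) R) :
    (slice p₁ m₁ p₂ m₂ a).trace = p₁ - m₁ + (p₂ - m₂) := by
  simp only [slice, trace_fromBlocks, trace_signMatrix, trace_neg]
  ring

lemma slice_map {S : Type*} [CommRing S] (f : R →+* S) (a : Matrix (Fin n) (Fin n) R) :
    (slice p₁ m₁ p₂ m₂ a).map f = slice p₁ m₁ p₂ m₂ (a.map f) := by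
  have h : (1 - a * a).map f = 1 - a.map f * a.map f := by
    
    rw [← RingHom.mapMatrix_apply, ← RingHom.mapMatrix_apply, map_sub, map_one, map_mul]
  have h1 : (1 : Matrix (Fin n) (Fin n) R).map f = 1 := by
    rw [← RingHom.mapMatrix_apply, map_one]
  have h2 : (-a).map f = - a.map f := by
    rw [← RingHom.mapMatrix_apply, ← RingHom.mapMatrix_apply, map_neg]
  simp [slice, fromBlocks_map, signMatrix_map, h, h1, h2, Matrix.map_zero]

end Slice

/-! ### Bases made of eigenvectors -/

section NormalForm

variable {K : Type*} [Field K] {n p m : ℕ}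

/-- The columns of this matrix are given by three families of vectors. -/
def frame {I : Type*} (v : Fin n → I → K) (u : Fin p → I → K) (w : Fin m → I → K) :
    Matrix I (Idx n p m) K :=
  (of (Sum.elim v (Sum.elim u w)))ᵀ

lemma mul_frame {I J : Type*} [Fintype I] (c : Matrix J I K) (v : Fin n → I → K)
    (u : Fin p → I → K) (w : Fin m → I → K) :
    c * frame v u w = frame (fun i => c *ᵥ v i) (fun i => c *ᵥ u i) (fun i => c *ᵥ w i) := by
  ext i (j | j | j) <;> rfl

lemma frame_mul_fromBlocks_diagonal {I : Type*} [Fintype I] (v : Fin n → I → K)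
    (u : Fin p → I → K) (w : Fin m → I → K) (x : Fin n → K) :
    frame v u w * fromBlocks (diagonal x) 0 0 (signMatrix K p m) =
      frame (fun i => x i • v i) u (-w) := by
  rw [signMatrix, fromBlocks_diagonal]
  ext i (j | j | j) <;> simp [mul_diagonal, frame, mul_comm]

lemma frame_mul_fromBlocks_diagonal_zero {I : Type*} [Fintype I] {p' m' : ℕ} (v : Fin n → I → K)
    (u : Fin p → I → K) (w : Fin m → I → K) (x : Fin n → K) :
    frame v u w * (fromBlocks (diagonal x) 0 0 0 : Matrix (Idx n p m) (Idx n p' m') K) =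
      frame (fun i => x i • v i) 0 0 := by
  ext i (j | j)
  · rw [mul_apply, Fintype.sum_sum_type]
    simp [frame, diagonal_apply, mul_comm]
  · rw [mul_apply, Fintype.sum_sum_type]
    rcases j with j | j <;> simp [frame]

/-- The columns are eigenvectors of `a`. Eigenvectors for different eigenvalues are independent;
within one eigenvalue there is either a single `v i`, or the family `u`, or the family `w`. -/
lemma isUnit_frame [CharZero K] (a : Matrix (Idx n p m) (Idx n p m) K)
    {v : Fin n → _ → K} {u : Fin p → _ → K} {w : Fin m → _ → K} {x : Fin n → K}
    (hv : ∀ i, a *ᵥ v i = x i • v i) (hv0 : ∀ i, v i ≠ 0) (hx : Function.Injective x)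
    (h1 : ∀ i, x i ≠ 1) (h2 : ∀ i, x i ≠ -1)
    (hu : ∀ i, a *ᵥ u i = u i) (hu' : LinearIndependent K u)
    (hw : ∀ i, a *ᵥ w i = - w i) (hw' : LinearIndependent K w) :
    IsUnit (frame v u w) := by
  rw [← linearIndependent_cols_iff_isUnit]
  have h12 : (1 : K) ≠ -1 := by
    intro h
    have : (2 : K) = 0 := by linear_combination h
    exact two_ne_zero this
  refine linearIndependent_of_eigenvectors (toLin' a) _ (Sum.elim x (Sum.elim 1 (-1))) ?_ ?_
  · rintro (i | i | i)
    · simpa [toLin'_apply] using! hv i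
    · simpa [toLin'_apply] using! hu i
    · simpa [toLin'_apply] using! hw i
  · intro g y hg hsum
    have hsum' : ∑ i, g (.inl i) • v i + (∑ i, g (.inr (.inl i)) • u i +
        ∑ i, g (.inr (.inr i)) • w i) = 0 := by
      rw [← hsum, Fintype.sum_sum_type, Fintype.sum_sum_type]; rfl
    by_cases hy1 : y = 1
    · have e1 : ∀ i, g (.inl i) = 0 := fun i => hg _ (by simpa [hy1] using h1 i)
      have e3 : ∀ i, g (.inr (.inr i)) = 0 := fun i => hg _ (by simpa [hy1] using h12.symm)
      simp only [e1, e3, zero_smul, Finset.sum_const_zero, zero_add, add_zero] at hsum'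
      have e2 := Fintype.linearIndependent_iff.1 hu' _ hsum'
      rintro (i | i | i) <;> simp [e1, e2, e3]
    by_cases hy2 : y = -1
    · have e1 : ∀ i, g (.inl i) = 0 := fun i => hg _ (by simpa [hy2] using h2 i)
      have e2 : ∀ i, g (.inr (.inl i)) = 0 := fun i => hg _ (by simpa [hy2] using h12)
      simp only [e1, e2, zero_smul, Finset.sum_const_zero, zero_add] at hsum'
      have e3 := Fintype.linearIndependent_iff.1 hw' _ hsum'
      rintro (i | i | i) <;> simp [e1, e2, e3]
    have e2 : ∀ i, g (.inr (.inl i)) = 0 := fun i => hg _ (by simpa using Ne.symm hy1)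
    have e3 : ∀ i, g (.inr (.inr i)) = 0 := fun i => hg _ (by simpa using Ne.symm hy2)
    simp only [e2, e3, zero_smul, Finset.sum_const_zero, add_zero] at hsum'
    have e1 : ∀ i, g (.inl i) = 0 := fun i => by
      by_cases hi : x i = y
      · rw [Finset.sum_eq_single i] at hsum'
        · exact (smul_eq_zero.1 hsum').resolve_right (hv0 i)
        · intro j _ hj
          rw [hg _ (by simpa [← hi] using fun h => hj (hx h)), zero_smul]
        · simp
      · exact hg _ (by simpa using hi)
    rintro (i | i | i) <;> simp [e1, e2, e3]

lemma exists_family_of_le_finrank {V : Type*} [AddCommGroup V] [Module K V] {W : Submodule K V}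
    {r : ℕ} (h : r ≤ finrank K W) : ∃ u : Fin r → V, LinearIndependent K u ∧ ∀ i, u i ∈ W := by
  obtain ⟨u, hu⟩ := exists_linearIndependent_of_le_finrank h
  exact ⟨fun i => u i, hu.map' W.subtype W.ker_subtype, fun i => (u i).2⟩

lemma exists_eigenvector_of_isRoot_charpoly {I : Type*} [Fintype I] [DecidableEq I]
    {a : Matrix I I K} {x : K} (h : a.charpoly.IsRoot x) : ∃ v ≠ 0, a *ᵥ v = x • v := by
  rw [Polynomial.IsRoot, eval_charpoly, ← exists_mulVec_eq_zero_iff] at h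
  obtain ⟨v, hv, h⟩ := h
  refine ⟨v, hv, ?_⟩
  rw [sub_mulVec, sub_eq_zero] at h
  rw [← h]; ext i; simp [scalar_apply, mulVec_diagonal]

end NormalForm

/-! ### Normal form of a generic block involution -/

section BlockInvolution

variable {K : Type*} [Field K] [CharZero K] {n p₁ m₁ p₂ m₂ : ℕ}

variable {a : Matrix (Idx n p₁ m₁) (Idx n p₁ m₁) K} {b : Matrix (Idx n p₁ m₁) (Idx n p₂ m₂) K}
  {c : Matrix (Idx n p₂ m₂) (Idx n p₁ m₁) K} {e : Matrix (Idx n p₂ m₂) (Idx n p₂ m₂) K}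

/-- The fixed space has dimension `n + p₁ + p₂` and the second block has size `n + p₂ + m₂`. This
leaves at least `p₁ - m₂` dimensions in the first block, which suffices when one of the two numbers
vanishes. -/
lemma le_finrank_plus (hs : fromBlocks a b c e * fromBlocks a b c e = 1)
    (ht : a.trace + e.trace = p₁ - m₁ + (p₂ - m₂)) (h1 : p₁ = 0 ∨ m₂ = 0) :
    p₁ ≤ finrank K
      (End.eigenspace (toLin' a) 1 ⊓ LinearMap.ker (toLin' c) : Submodule K (Idx n p₁ m₁ → K)) := by
  rcases h1 with rfl | rfl
  · exact Nat.zero_le _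
  · refine le_finrank_eigenspace_one_inf_ker hs ?_
    rw [ht]; push_cast [Fintype.card_sum, Fintype.card_fin]; ring

lemma le_finrank_minus (hs : fromBlocks a b c e * fromBlocks a b c e = 1)
    (ht : a.trace + e.trace = p₁ - m₁ + (p₂ - m₂)) (h2 : m₁ = 0 ∨ p₂ = 0) :
    m₁ ≤ finrank K
      (End.eigenspace (toLin' a) (-1) ⊓ LinearMap.ker (toLin' c) : Submodule K (Idx n p₁ m₁ → K)) := by
  rcases h2 with rfl | rfl
  · exact Nat.zero_le _
  · refine le_finrank_eigenspace_neg_one_inf_ker hs ?_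
    rw [ht]; push_cast [Fintype.card_sum, Fintype.card_fin]; ring

omit [CharZero K] in
lemma fromBlocks_swap_mul_self (hs : fromBlocks a b c e * fromBlocks a b c e = 1) :
    fromBlocks e c b a * fromBlocks e c b a = 1 := by
  rw [fromBlocks_multiply, ← fromBlocks_one, fromBlocks_inj] at hs ⊢
  obtain ⟨h1, h2, h3, h4⟩ := hs
  rw [add_comm] at h1 h2 h3 h4
  exact ⟨h4, h3, h2, h1⟩

/-- The polynomial `(t - 1) ^ p₁ (t + 1) ^ m₁` divides the characteristic polynomial of the upper
left block. -/
lemma dvd_charpoly (hs : fromBlocks a b c e * fromBlocks a b c e = 1)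
    (ht : a.trace + e.trace = p₁ - m₁ + (p₂ - m₂)) (h1 : p₁ = 0 ∨ m₂ = 0)
    (h2 : m₁ = 0 ∨ p₂ = 0) :
    (Polynomial.X - 1) ^ p₁ * (Polynomial.X + 1) ^ m₁ ∣ a.charpoly := by
  have hp := (le_finrank_plus hs ht h1).trans (Submodule.finrank_mono inf_le_left)
  have hm := (le_finrank_minus hs ht h2).trans (Submodule.finrank_mono inf_le_left)
  replace hp := hp.trans (LinearMap.finrank_eigenspace_le _ _)
  replace hm := hm.trans (LinearMap.finrank_eigenspace_le _ _)
  rw [charpoly_toLin', Polynomial.le_rootMultiplicity_iff (charpoly_monic a).ne_zero] at hp hm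
  refine IsCoprime.mul_dvd (IsCoprime.pow ?_) (by simpa using hp) (by simpa using hm)
  -- Bézout: half the difference of `X + 1` and `X - 1` is `1`.
  refine ⟨-Polynomial.C (2⁻¹), Polynomial.C (2⁻¹), ?_⟩
  have : (Polynomial.C (2⁻¹ : K)) * 2 = 1 := by
    rw [← Polynomial.C_ofNat, ← Polynomial.C_mul, inv_mul_cancel₀ two_ne_zero, Polynomial.C_1]
  linear_combination this

/-- If the upper left block of an involution has `n` distinct eigenvalues other than `1` and `-1`,
then the involution is conjugate to a standard one by a block diagonal matrix. -/
lemma exists_conj_slice_diagonal (hs : fromBlocks a b c e * fromBlocks a b c e = 1)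
    (ht : a.trace + e.trace = p₁ - m₁ + (p₂ - m₂)) (h1 : p₁ = 0 ∨ m₂ = 0)
    (h2 : m₁ = 0 ∨ p₂ = 0) {x : Fin n → K} (hx : Function.Injective x)
    (hx1 : ∀ i, x i ≠ 1) (hx2 : ∀ i, x i ≠ -1) (hroot : ∀ i, a.charpoly.IsRoot (x i)) :
    ∃ (g : Matrix (Idx n p₁ m₁) (Idx n p₁ m₁) K) (h : Matrix (Idx n p₂ m₂) (Idx n p₂ m₂) K), IsUnit g ∧ IsUnit h ∧
      fromBlocks a b c e * fromBlocks g 0 0 h =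
        fromBlocks g 0 0 h * slice p₁ m₁ p₂ m₂ (diagonal x) := by
  -- Exchanging the blocks supplies the eigenvectors inside the second block by the same count.
  have hs' := fromBlocks_swap_mul_self hs
  have ht' : e.trace + a.trace = p₂ - m₂ + (p₁ - m₁) := by rw [add_comm, ht, add_comm]
  have fu := le_finrank_plus hs ht h1
  have fw := le_finrank_minus hs ht h2
  have fu₂ := le_finrank_plus hs' ht' h2.symm
  have fw₂ := le_finrank_minus hs' ht' h1.symm
  obtain ⟨u, hu, hu'⟩ := exists_family_of_le_finrank fu
  obtain ⟨w, hw, hw'⟩ := exists_family_of_le_finrank fw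
  obtain ⟨u₂, hu₂, hu₂'⟩ := exists_family_of_le_finrank fu₂
  obtain ⟨w₂, hw₂, hw₂'⟩ := exists_family_of_le_finrank fw₂
  choose v hv0 hv using fun i => exists_eigenvector_of_isRoot_charpoly (hroot i)
  simp only [Submodule.mem_inf, End.mem_eigenspace_iff, LinearMap.mem_ker, toLin'_apply,
    one_smul, neg_smul] at hu' hw' hu₂' hw₂'
  rw [fromBlocks_multiply, ← fromBlocks_one, fromBlocks_inj] at hs
  obtain ⟨s1, -, s3, -⟩ := hs
  -- From `a² + bc = 1`; likewise `ca + ec = 0` gives `hec`. These are the relations that appear in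
  -- `slice`.
  have hbc : ∀ i, b *ᵥ c *ᵥ v i = (1 - x i * x i) • v i := fun i => by
    have := congrArg (· *ᵥ v i) s1
    simp only [add_mulVec, ← mulVec_mulVec, hv, mulVec_smul, one_mulVec] at this
    rw [sub_smul, one_smul, mul_smul, eq_sub_iff_add_eq, add_comm, this]
  have hec : ∀ i, e *ᵥ c *ᵥ v i = (-x i) • c *ᵥ v i := fun i => by
    have := congrArg (· *ᵥ v i) s3
    simp only [add_mulVec, ← mulVec_mulVec, hv, mulVec_smul, zero_mulVec] at this
    rw [neg_smul, eq_neg_iff_add_eq_zero, add_comm, this]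
  -- Here `x i ≠ 1` and `x i ≠ -1` are needed: they make `1 - x i ^ 2` nonzero.
  have hcv : ∀ i, c *ᵥ v i ≠ 0 := fun i h0 => by
    have := hbc i
    rw [h0, mulVec_zero, eq_comm, smul_eq_zero] at this
    have h3 : (1 - x i) * (1 + x i) = 0 := by
      linear_combination this.resolve_right (hv0 i)
    rcases mul_eq_zero.1 h3 with h | h
    · exact hx1 i (by linear_combination -h)
    · exact hx2 i (by linear_combination h)
  refine ⟨frame v u w, frame (fun i => c *ᵥ v i) u₂ w₂, ?_, ?_, ?_⟩
  · exact isUnit_frame a hv hv0 hx hx1 hx2 (fun i => (hu' i).1) hu (fun i => (hw' i).1) hw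
  · exact isUnit_frame e hec hcv (fun i j h => hx (neg_injective h))
      (fun i h => hx2 i (by linear_combination -h)) (fun i h => hx1 i (by linear_combination -h))
      (fun i => (hu₂' i).1) hu₂ (fun i => (hw₂' i).1) hw₂
  · have d1 : (1 : Matrix (Fin n) (Fin n) K) - diagonal x * diagonal x =
        diagonal fun i => 1 - x i * x i := by
      rw [diagonal_mul_diagonal, ← diagonal_one, diagonal_sub]
    rw [slice, fromBlocks_multiply, fromBlocks_multiply]
    simp only [Matrix.mul_zero, Matrix.zero_mul, add_zero, zero_add]
    rw [d1, diagonal_neg, ← diagonal_one, frame_mul_fromBlocks_diagonal,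
      frame_mul_fromBlocks_diagonal_zero, frame_mul_fromBlocks_diagonal_zero,
      frame_mul_fromBlocks_diagonal, mul_frame, mul_frame, mul_frame, mul_frame]
    congr 2
    · funext i; exact hv i
    · funext i; exact (hu' i).1
    · funext i; exact (hw' i).1
    · funext i; exact hbc i
    · funext i; exact (hu₂' i).2
    · funext i; exact (hw₂' i).2
    · funext i; simp
    · funext i; exact (hu' i).2
    · funext i; exact (hw' i).2
    · funext i; exact hec i
    · funext i; exact (hu₂' i).1
    · funext i; exact (hw₂' i).1

end BlockInvolution

/-! ### Matrices with prescribed characteristic polynomial -/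

section Companion

open Polynomial

variable {R : Type*} [CommRing R] {n : ℕ}

/-- The monic polynomial of degree `n` with given lower coefficients. -/
noncomputable def monicOfCoeffs (c : Fin n → R) : R[X] :=
  X ^ n + ∑ i : Fin n, C (c i) * X ^ (i : ℕ)

lemma monic_monicOfCoeffs (c : Fin n → R) : (monicOfCoeffs c).Monic :=
  monic_X_pow_add (degree_sum_fin_lt c)

lemma natDegree_monicOfCoeffs [Nontrivial R] (c : Fin n → R) :
    (monicOfCoeffs c).natDegree = n := by
  rw [monicOfCoeffs, natDegree_add_eq_left_of_degree_lt, natDegree_X_pow]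
  rw [degree_X_pow]
  exact degree_sum_fin_lt c

lemma coeff_monicOfCoeffs (c : Fin n → R) (i : Fin n) : (monicOfCoeffs c).coeff i = c i := by
  simp only [monicOfCoeffs, coeff_add, coeff_X_pow, finsetSum_coeff, coeff_C_mul]
  rw [if_neg i.2.ne, zero_add, Finset.sum_eq_single i]
  · simp
  · intro j _ hj
    rw [if_neg (fun h => hj (Fin.ext h.symm)), mul_zero]
  · simp

lemma monicOfCoeffs_map {S : Type*} [CommRing S] (f : R →+* S) (c : Fin n → R) :
    (monicOfCoeffs c).map f = monicOfCoeffs fun i => f (c i) := by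
  simp [monicOfCoeffs, Polynomial.map_sum]

lemma monicOfCoeffs_coeff {p : R[X]} (hp : p.Monic) (hn : p.natDegree = n) :
    monicOfCoeffs (fun i : Fin n => p.coeff i) = p := by
  conv_rhs => rw [hp.as_sum, hn]
  rw [monicOfCoeffs, Finset.sum_range]

/-- Multiplication by the root on `R[t]/(p)` has the minimal polynomial of the root as
characteristic polynomial. It is divisible by `p` because it kills the root, and the degrees agree.
-/
lemma exists_charpoly_eq_of_monic [Nontrivial R] {p : R[X]} (hp : p.Monic)
    (hn : p.natDegree = n) : ∃ a : Matrix (Fin n) (Fin n) R, a.charpoly = p := by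
  let pb := AdjoinRoot.powerBasis' hp
  have hd : pb.dim = n := by rw [← hn]; rfl
  refine ⟨(Algebra.leftMulMatrix pb.basis pb.gen).reindex (finCongr hd) (finCongr hd), ?_⟩
  rw [charpoly_reindex, charpoly_leftMulMatrix]
  have hm : (minpoly R pb.gen).Monic := by
    rw [← charpoly_leftMulMatrix]; exact charpoly_monic _
  have hdeg : (minpoly R pb.gen).natDegree = p.natDegree := by
    rw [← charpoly_leftMulMatrix, charpoly_natDegree_eq_dim, Fintype.card_fin, hd, hn]
  refine (eq_of_monic_of_dvd_of_natDegree_le hp hm ?_ hdeg.le)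
  rw [← AdjoinRoot.mk_eq_zero, ← AdjoinRoot.aeval_eq]
  exact minpoly.aeval R pb.gen

variable (R n) in
/-- A matrix over a polynomial ring whose characteristic polynomial is the generic monic
polynomial of degree `n`. -/
noncomputable def companion [Nontrivial R] : Matrix (Fin n) (Fin n) (MvPolynomial (Fin n) R) :=
  (exists_charpoly_eq_of_monic (monic_monicOfCoeffs MvPolynomial.X)
    (natDegree_monicOfCoeffs (MvPolynomial.X (R := R)))).choose

lemma charpoly_companion_map_eval [Nontrivial R] (k : Fin n → R) :
    ((companion R n).map (MvPolynomial.eval k)).charpoly = monicOfCoeffs k := by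
  rw [charpoly_map, companion, (exists_charpoly_eq_of_monic (monic_monicOfCoeffs MvPolynomial.X)
    (natDegree_monicOfCoeffs (MvPolynomial.X (R := R)))).choose_spec, monicOfCoeffs_map]
  simp

end Companion

/-! ### The polynomial `χ` of a block matrix -/

section Chi

open Polynomial

variable {R : Type*} [CommRing R] {n p₁ m₁ p₂ m₂ : ℕ}

variable (R) in
/-- The characteristic polynomial of `signMatrix`. -/
noncomputable def signPoly (p m : ℕ) : R[X] := (X - 1) ^ p * (X + 1) ^ m

lemma monic_signPoly (p m : ℕ) : (signPoly R p m).Monic :=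
  ((by simpa using monic_X_sub_C (1 : R) : (X - 1 : R[X]).Monic).pow _).mul
    ((by simpa using monic_X_add_C (1 : R) : (X + 1 : R[X]).Monic).pow _)

lemma natDegree_signPoly [Nontrivial R] (p m : ℕ) : (signPoly R p m).natDegree = p + m := by
  have h1 : (X - 1 : R[X]).Monic := by simpa using monic_X_sub_C (1 : R)
  have h2 : (X + 1 : R[X]).Monic := by simpa using monic_X_add_C (1 : R)
  rw [signPoly, (h1.pow _).natDegree_mul (h2.pow _), h1.natDegree_pow, h2.natDegree_pow,
    ← C_1, natDegree_X_sub_C, natDegree_X_add_C, mul_one, mul_one]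

lemma signPoly_map {S : Type*} [CommRing S] (f : R →+* S) (p m : ℕ) :
    (signPoly R p m).map f = signPoly S p m := by
  simp [signPoly]

lemma charpoly_signMatrix (p m : ℕ) : (signMatrix R p m).charpoly = signPoly R p m := by
  simp [signMatrix, charpoly_diagonal, signPoly, Fintype.prod_sum_type]

/-- The characteristic polynomial of the upper left block, divided by `signPoly`. -/
noncomputable def blockChi {I J : Type*} [Fintype I] [DecidableEq I] (p m : ℕ)
    (s : Matrix (I ⊕ J) (I ⊕ J) R) : R[X] :=
  s.toBlocks₁₁.charpoly /ₘ signPoly R p m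

/-- Division with remainder by a monic polynomial commutes with ring maps, even if it is not exact.
Hence the coefficients of `blockChi` are polynomials in the entries of an arbitrary matrix. -/
lemma blockChi_map {I J S : Type*} [Fintype I] [DecidableEq I] [CommRing S] (f : R →+* S)
    (p m : ℕ) (s : Matrix (I ⊕ J) (I ⊕ J) R) :
    blockChi p m (s.map f) = (blockChi p m s).map f := by
  rw [blockChi, blockChi, map_divByMonic _ (monic_signPoly p m), signPoly_map, ← charpoly_map]
  rfl

lemma charpoly_toBlocks₁₁_slice (a : Matrix (Fin n) (Fin n) R) :
    (slice p₁ m₁ p₂ m₂ a).toBlocks₁₁.charpoly = signPoly R p₁ m₁ * a.charpoly := by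
  rw [slice, toBlocks_fromBlocks₁₁, charpoly_fromBlocks_zero₁₂, charpoly_signMatrix, mul_comm]

lemma blockChi_slice (a : Matrix (Fin n) (Fin n) R) :
    blockChi p₁ m₁ (slice p₁ m₁ p₂ m₂ a) = a.charpoly := by
  rw [blockChi, charpoly_toBlocks₁₁_slice, mul_divByMonic_cancel_left _ (monic_signPoly _ _)]

lemma natDegree_blockChi [Nontrivial R]
    (s : Matrix (Idx n p₁ m₁ ⊕ Idx n p₂ m₂) (Idx n p₁ m₁ ⊕ Idx n p₂ m₂) R) :
    (blockChi p₁ m₁ s).natDegree = n := by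
  rw [blockChi, natDegree_divByMonic _ (monic_signPoly _ _), charpoly_natDegree_eq_dim,
    natDegree_signPoly]
  simp

lemma monic_blockChi [Nontrivial R]
    (s : Matrix (Idx n p₁ m₁ ⊕ Idx n p₂ m₂) (Idx n p₁ m₁ ⊕ Idx n p₂ m₂) R) :
    (blockChi p₁ m₁ s).Monic := by
  rw [Monic, blockChi, leadingCoeff_divByMonic_of_monic (monic_signPoly _ _),
    (charpoly_monic _).leadingCoeff]
  rw [degree_eq_natDegree (monic_signPoly _ _).ne_zero, degree_eq_natDegree (charpoly_monic _).ne_zero,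
    charpoly_natDegree_eq_dim, natDegree_signPoly]
  exact_mod_cast (by simp)

end Chi

/-! ### Irreducibility of conjugacy classes -/

section Density

variable {K : Type*} [Field K] {m : Type*} [Fintype m] [DecidableEq m]

/-- The entries of a matrix, as a point of an affine space. -/
def entries {R m : Type*} (a : Matrix m m R) : m × m → R := fun p => a p.1 p.2

lemma eval_entries_det (a : Matrix m m K) :
    MvPolynomial.eval (entries a) (mvPolynomialX m m K).det = a.det := by
  rw [RingHom.map_det]; exact congrArg det (mvPolynomialX_mapMatrix_eval a)

/-- Since `g t adj(g) = det g • g t g⁻¹`, each factor of degree one in the entries costs one power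
of the determinant. -/
lemma exists_eval_eq_det_pow_mul (t : Matrix m m K) (E : MvPolynomial (m × m) K) :
    ∃ (k : ℕ) (E' : MvPolynomial (m × m) K), ∀ g : (Matrix m m K)ˣ,
      MvPolynomial.eval (entries g.val) E' =
        g.val.det ^ k * MvPolynomial.eval (entries (g.val * t * g⁻¹.val)) E := by
  induction E using MvPolynomial.induction_on with
  | C a => exact ⟨0, MvPolynomial.C a, fun g => by simp⟩
  | add p q hp hq =>
    obtain ⟨k, p', hp⟩ := hp
    obtain ⟨l, q', hq⟩ := hq
    refine ⟨k + l, (mvPolynomialX m m K).det ^ l * p' + (mvPolynomialX m m K).det ^ k * q',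
      fun g => ?_⟩
    rw [map_add, map_mul, map_mul, hp, hq, map_pow, map_pow, eval_entries_det, map_add]
    ring
  | mul_X p i hp =>
    obtain ⟨k, p', hp⟩ := hp
    refine ⟨k + 1, p' * (mvPolynomialX m m K * t.map (MvPolynomial.C (σ := m × m)) *
      (mvPolynomialX m m K).adjugate : Matrix m m (MvPolynomial (m × m) K)) i.1 i.2, fun g => ?_⟩
    have h1 : (MvPolynomial.eval (entries g.val)).mapMatrix (mvPolynomialX m m K *
        t.map (MvPolynomial.C (σ := m × m)) * (mvPolynomialX m m K).adjugate) =
        g.val.det • (g.val * t * g⁻¹.val) := by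
      have h2 : (MvPolynomial.eval (entries g.val)).mapMatrix (t.map (MvPolynomial.C (σ := m × m))) = t := by
        ext; simp
      have h3 : (MvPolynomial.eval (entries g.val)).mapMatrix (mvPolynomialX m m K) = g.val :=
        mvPolynomialX_mapMatrix_eval g.val
      rw [map_mul, map_mul, RingHom.map_adjugate, h2, h3, coe_units_inv, Matrix.inv_def,
        mul_smul_comm, smul_smul, Ring.mul_inverse_cancel _ ((isUnit_iff_isUnit_det _).1 g.isUnit),
        one_smul]
    have h4 := congrFun (congrFun h1 i.1) i.2
    rw [RingHom.mapMatrix_apply, map_apply, Matrix.smul_apply, smul_eq_mul] at h4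
    rw [map_mul, h4, hp, map_mul, MvPolynomial.eval_X, entries, pow_succ]
    ring

/-- The conjugacy class of a matrix is irreducible. -/
lemma eval_eq_zero_of_conj [Infinite K] (t : Matrix m m K) (E D : MvPolynomial (m × m) K)
    (h : ∀ g : (Matrix m m K)ˣ, MvPolynomial.eval (entries (g.val * t * g⁻¹.val)) D ≠ 0 →
      MvPolynomial.eval (entries (g.val * t * g⁻¹.val)) E = 0)
    (hD : ∃ g : (Matrix m m K)ˣ, MvPolynomial.eval (entries (g.val * t * g⁻¹.val)) D ≠ 0)
    (g : (Matrix m m K)ˣ) : MvPolynomial.eval (entries (g.val * t * g⁻¹.val)) E = 0 := by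
  obtain ⟨k, E', hE'⟩ := exists_eval_eq_det_pow_mul t E
  obtain ⟨l, D', hD'⟩ := exists_eval_eq_det_pow_mul t D
  have hdet : ∀ g : (Matrix m m K)ˣ, g.val.det ≠ 0 := fun g =>
    ((isUnit_iff_isUnit_det _).1 g.isUnit).ne_zero
  -- Pulled back to `g`, the hypothesis says that this polynomial vanishes at all matrices: the
  -- determinant covers the singular ones. A polynomial ring over a field is a domain, so `E'`
  -- itself vanishes.
  have key : E' * D' * (mvPolynomialX m m K).det = 0 := by
    refine MvPolynomial.funext fun y => ?_
    obtain ⟨a, rfl⟩ : ∃ a : Matrix m m K, entries a = y := ⟨of fun i j => y (i, j), rfl⟩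
    rw [map_mul, map_mul, eval_entries_det, map_zero]
    by_cases ha : a.det = 0
    · rw [ha, mul_zero]
    obtain ⟨u, rfl⟩ := (isUnit_iff_isUnit_det a).2 (isUnit_iff_ne_zero.2 ha)
    rw [hE', hD']
    by_cases hu : MvPolynomial.eval (entries (u.val * t * u⁻¹.val)) D = 0
    · rw [hu, mul_zero, mul_zero, zero_mul]
    · rw [h u hu, mul_zero, zero_mul, zero_mul]
  have hD0 : D' ≠ 0 := fun h0 => by
    obtain ⟨g, hg⟩ := hD
    have := hD' g
    rw [h0, map_zero, eq_comm] at this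
    exact (mul_ne_zero (pow_ne_zero _ (hdet g)) hg) this
  have hE0 : E' = 0 := by
    simpa [hD0, det_mvPolynomialX_ne_zero] using key
  have := hE' g
  rw [hE0, map_zero, eq_comm] at this
  exact (mul_eq_zero.1 this).resolve_left (pow_ne_zero _ (hdet g))

end Density

lemma eval_bind₁ {R σ τ : Type*} [CommRing R] (g : τ → R) (h : σ → MvPolynomial τ R)
    (f : MvPolynomial σ R) : MvPolynomial.eval g (MvPolynomial.bind₁ h f) =
      MvPolynomial.eval (fun i => MvPolynomial.eval g (h i)) f :=
  MvPolynomial.eval₂Hom_bind₁ _ _ _ _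

/-! ### Invariant polynomials on a class of involutions -/

section Invariants

variable {K : Type*} [Field K] {n p₁ m₁ p₂ m₂ : ℕ}

variable (K n p₁ m₁ p₂ m₂) in
/-- The involutions of a vector space in which the multiplicities of the eigenvalues
`1` and `-1` are `n + p₁ + p₂` and `n + m₁ + m₂`. -/
def involutions : Set (Matrix (Idx n p₁ m₁ ⊕ Idx n p₂ m₂) (Idx n p₁ m₁ ⊕ Idx n p₂ m₂) K) :=
  {s | s * s = 1 ∧ s.trace = p₁ - m₁ + (p₂ - m₂)}

lemma slice_mem_involutions (a : Matrix (Fin n) (Fin n) K) :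
    slice p₁ m₁ p₂ m₂ a ∈ involutions K n p₁ m₁ p₂ m₂ :=
  ⟨slice_mul_self a, trace_slice a⟩

lemma conj_mem_involutions {s : Matrix (Idx n p₁ m₁ ⊕ Idx n p₂ m₂) (Idx n p₁ m₁ ⊕ Idx n p₂ m₂) K}
    (hs : s ∈ involutions K n p₁ m₁ p₂ m₂) (g : (Matrix _ _ K)ˣ) :
    g.val * s * g⁻¹.val ∈ involutions K n p₁ m₁ p₂ m₂ := by
  refine ⟨?_, ?_⟩
  · calc g.val * s * g⁻¹.val * (g.val * s * g⁻¹.val)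
        = g.val * s * (g⁻¹.val * g.val) * s * g⁻¹.val := by simp only [mul_assoc]
      _ = g.val * (s * s) * g⁻¹.val := by rw [Units.inv_mul, mul_one, mul_assoc g.val]
      _ = 1 := by rw [hs.1, mul_one, Units.mul_inv]
  · rw [trace_mul_comm, ← mul_assoc, Units.inv_mul, one_mul, hs.2]

variable [CharZero K]

lemma signPoly_dvd_charpoly
    {s : Matrix (Idx n p₁ m₁ ⊕ Idx n p₂ m₂) (Idx n p₁ m₁ ⊕ Idx n p₂ m₂) K}
    (hs : s ∈ involutions K n p₁ m₁ p₂ m₂) (h1 : p₁ = 0 ∨ m₂ = 0) (h2 : m₁ = 0 ∨ p₂ = 0) :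
    signPoly K p₁ m₁ ∣ s.toBlocks₁₁.charpoly := by
  have h := hs.1
  have ht := hs.2
  rw [← fromBlocks_toBlocks s] at h ht
  rw [trace_fromBlocks] at ht
  exact dvd_charpoly h ht h1 h2

lemma signPoly_mul_blockChi
    {s : Matrix (Idx n p₁ m₁ ⊕ Idx n p₂ m₂) (Idx n p₁ m₁ ⊕ Idx n p₂ m₂) K}
    (hs : s ∈ involutions K n p₁ m₁ p₂ m₂) (h1 : p₁ = 0 ∨ m₂ = 0) (h2 : m₁ = 0 ∨ p₂ = 0) :
    signPoly K p₁ m₁ * blockChi p₁ m₁ s = s.toBlocks₁₁.charpoly := by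
  obtain ⟨r, hr⟩ := signPoly_dvd_charpoly hs h1 h2
  rw [blockChi, hr, Polynomial.mul_divByMonic_cancel_left _ (monic_signPoly _ _)]

lemma exists_roots_of_separable [IsAlgClosed K] {q : K[X]} (hn : q.natDegree = n)
    (hsep : (q * (Polynomial.X ^ 2 - 1)).Separable) :
    ∃ x : Fin n → K, Function.Injective x ∧ (∀ i, x i ≠ 1) ∧ (∀ i, x i ≠ -1) ∧
      ∀ i, q.IsRoot (x i) := by
  classical
  have h1 : Multiset.card q.roots = n := by
    rw [← hn, (IsAlgClosed.splits q).natDegree_eq_card_roots]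
  have hr : ∀ y ∈ q.roots, q.eval y = 0 := fun y hy => (Polynomial.mem_roots'.1 hy).2
  have hcop : ∀ y ∈ q.roots, y ^ 2 - 1 ≠ 0 := fun y hy h0 => by
    obtain ⟨u, v, huv⟩ := hsep.isCoprime
    have := congrArg (Polynomial.eval y) huv
    simp [hr y hy, h0] at this
  have hc : q.roots.toFinset.card = n := by
    rw [Multiset.toFinset_card_of_nodup (Polynomial.nodup_roots hsep.of_mul_left), h1]
  let e := (Finset.equivFinOfCardEq hc).symm
  have he : ∀ i, (e i : K) ∈ q.roots := fun i => Multiset.mem_toFinset.1 (e i).2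
  refine ⟨fun i => (e i : K), fun i j h => e.injective (Subtype.ext h), fun i h => ?_,
    fun i h => ?_, fun i => hr _ (he i)⟩
  · exact hcop _ (he i) (by dsimp only at h; rw [h]; ring)
  · exact hcop _ (he i) (by dsimp only at h; rw [h]; ring)

/-- Invariance under the matrices that commute with the standard involution. -/
def IsBlockInvariant (f : MvPolynomial
    ((Idx n p₁ m₁ ⊕ Idx n p₂ m₂) × (Idx n p₁ m₁ ⊕ Idx n p₂ m₂)) K) : Prop :=
  ∀ s ∈ involutions K n p₁ m₁ p₂ m₂, ∀ s' ∈ involutions K n p₁ m₁ p₂ m₂,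
    ∀ (g : Matrix (Idx n p₁ m₁) (Idx n p₁ m₁) K) (h : Matrix (Idx n p₂ m₂) (Idx n p₂ m₂) K),
    IsUnit g → IsUnit h → s * fromBlocks g 0 0 h = fromBlocks g 0 0 h * s' →
    MvPolynomial.eval (entries s) f = MvPolynomial.eval (entries s') f

lemma exists_conj_slice_diagonal_of_isRoot
    {s : Matrix (Idx n p₁ m₁ ⊕ Idx n p₂ m₂) (Idx n p₁ m₁ ⊕ Idx n p₂ m₂) K}
    (hs : s ∈ involutions K n p₁ m₁ p₂ m₂) (h1 : p₁ = 0 ∨ m₂ = 0) (h2 : m₁ = 0 ∨ p₂ = 0)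
    {x : Fin n → K} (hx : Function.Injective x)
    (hx1 : ∀ i, x i ≠ 1) (hx2 : ∀ i, x i ≠ -1) (hroot : ∀ i, (blockChi p₁ m₁ s).IsRoot (x i)) :
    ∃ (g : Matrix (Idx n p₁ m₁) (Idx n p₁ m₁) K) (h : Matrix (Idx n p₂ m₂) (Idx n p₂ m₂) K),
      IsUnit g ∧ IsUnit h ∧
      s * fromBlocks g 0 0 h = fromBlocks g 0 0 h * slice p₁ m₁ p₂ m₂ (diagonal x) := by
  have hroot' : ∀ i, s.toBlocks₁₁.charpoly.IsRoot (x i) := fun i => by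
    rw [← signPoly_mul_blockChi hs h1 h2, Polynomial.IsRoot, Polynomial.eval_mul, hroot i, mul_zero]
  have h := hs.1
  have ht := hs.2
  rw [← fromBlocks_toBlocks s] at h ht
  rw [trace_fromBlocks] at ht
  obtain ⟨g, g', hg⟩ := exists_conj_slice_diagonal h ht h1 h2 hx hx1 hx2 hroot'
  rw [fromBlocks_toBlocks] at hg
  exact ⟨g, g', hg⟩

lemma exists_injective_ne (n : ℕ) : ∃ x : Fin n → K, Function.Injective x ∧
    (∀ i, x i ≠ 1) ∧ ∀ i, x i ≠ -1 := by
  -- The integers from `2` on avoid `1` and `-1` in characteristic `0`.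
  refine ⟨fun i => ((i : ℕ) + 2 : ℕ), fun i j h => ?_, fun i h => ?_, fun i h => ?_⟩
  · exact Fin.ext (by simpa using h)
  · have := Nat.cast_eq_one.1 h
    omega
  · have h' : (((i : ℕ) + 2 + 1 : ℕ) : K) = 0 := by push_cast at h ⊢; linear_combination h
    exact absurd (Nat.cast_eq_zero.1 h') (by omega)

/-- A slice of the action: `blockChi` maps it isomorphically onto an affine space. -/
noncomputable def companionSlice (K : Type*) [Field K] (n p₁ m₁ p₂ m₂ : ℕ) (k : Fin n → K) :
    Matrix (Idx n p₁ m₁ ⊕ Idx n p₂ m₂) (Idx n p₁ m₁ ⊕ Idx n p₂ m₂) K :=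
  slice p₁ m₁ p₂ m₂ ((companion K n).map (MvPolynomial.eval k))

omit [CharZero K] in
lemma blockChi_companionSlice (k : Fin n → K) :
    blockChi p₁ m₁ (companionSlice K n p₁ m₁ p₂ m₂ k) = monicOfCoeffs k := by
  rw [companionSlice, blockChi_slice, charpoly_companion_map_eval]

/-- The invariants of the group of block diagonal matrices on a conjugacy class of
involutions are the polynomials in the coefficients of `blockChi`. -/
theorem exists_eval_blockChi_coeff [IsAlgClosed K] (h1 : p₁ = 0 ∨ m₂ = 0)
    (h2 : m₁ = 0 ∨ p₂ = 0) {f : MvPolynomial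
      ((Idx n p₁ m₁ ⊕ Idx n p₂ m₂) × (Idx n p₁ m₁ ⊕ Idx n p₂ m₂)) K}
    (hf : IsBlockInvariant f) :
    ∃ P : MvPolynomial (Fin n) K, ∀ s ∈ involutions K n p₁ m₁ p₂ m₂,
      MvPolynomial.eval (entries s) f =
        MvPolynomial.eval (fun i : Fin n => (blockChi p₁ m₁ s).coeff i) P := by
  let M := Idx n p₁ m₁ ⊕ Idx n p₂ m₂
  -- The restriction of `f` to the companion section; any solution must have these values.
  let P : MvPolynomial (Fin n) K :=
    MvPolynomial.bind₁ (entries (slice p₁ m₁ p₂ m₂ (companion K n))) f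
  have hP : ∀ k, MvPolynomial.eval k P =
      MvPolynomial.eval (entries (companionSlice K n p₁ m₁ p₂ m₂ k)) f := fun k => by
    rw [companionSlice, ← slice_map]
    simp only [P, eval_bind₁]
    rfl
  refine ⟨P, ?_⟩
  let Q : (MvPolynomial (M × M) K)[X] :=
    blockChi p₁ m₁ (mvPolynomialX M M K) * (Polynomial.X ^ 2 - 1)
  -- Up to normalization, the discriminant of `χ (t² - 1)`: it detects coincidences among the roots
  -- and the values `1`, `-1`. The degrees are prescribed so that the resultant commutes with
  -- specialization; they are the true degrees in characteristic `0`.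
  let Ds : MvPolynomial (M × M) K := Q.resultant (Polynomial.derivative Q) (n + 2) (n + 1)
  let E : MvPolynomial (M × M) K := f - MvPolynomial.bind₁
    (fun i : Fin n => (blockChi p₁ m₁ (mvPolynomialX M M K)).coeff i) P
  have hchi : ∀ s : Matrix M M K, (blockChi p₁ m₁ (mvPolynomialX M M K)).map
      (MvPolynomial.eval (entries s)) = blockChi p₁ m₁ s := fun s => by
    rw [← blockChi_map]
    congr 1
    exact mvPolynomialX_mapMatrix_eval s
  have hE : ∀ s : Matrix M M K, MvPolynomial.eval (entries s) E =
      MvPolynomial.eval (entries s) f -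
        MvPolynomial.eval (fun i : Fin n => (blockChi p₁ m₁ s).coeff i) P := fun s => by
    simp only [E, map_sub, eval_bind₁, ← hchi s, Polynomial.coeff_map]
  have hQ2 : ∀ s : Matrix M M K, (blockChi p₁ m₁ s * (Polynomial.X ^ 2 - 1)).natDegree = n + 2 :=
    fun s => by
    have h : (Polynomial.X ^ 2 - 1 : K[X]).Monic := Polynomial.monic_X_pow_sub_C 1 two_ne_zero
    rw [(monic_blockChi s).natDegree_mul h, natDegree_blockChi]
    congr 1
    exact Polynomial.natDegree_X_pow_sub_C (r := (1 : K))
  have hDs : ∀ s : Matrix M M K, MvPolynomial.eval (entries s) Ds ≠ 0 ↔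
      (blockChi p₁ m₁ s * (Polynomial.X ^ 2 - 1)).Separable := fun s => by
    have hQ : Q.map (MvPolynomial.eval (entries s)) =
        blockChi p₁ m₁ s * (Polynomial.X ^ 2 - 1) := by
      simp [Q, hchi]
    have hne : blockChi p₁ m₁ s * (Polynomial.X ^ 2 - 1) ≠ 0 := fun h0 => by
      have := hQ2 s
      rw [h0] at this
      simp at this
    have hdeg : (Polynomial.derivative
        (blockChi p₁ m₁ s * (Polynomial.X ^ 2 - 1))).natDegree = n + 1 := by
      rw [Polynomial.natDegree_derivative, hQ2]; rfl
    simp only [Ds]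
    rw [← Polynomial.resultant_map_map, ← Polynomial.derivative_map, hQ, Polynomial.Separable,
      ← not_iff_not, not_not]
    have := Polynomial.resultant_eq_zero_iff (f := blockChi p₁ m₁ s * (Polynomial.X ^ 2 - 1))
      (g := Polynomial.derivative (blockChi p₁ m₁ s * (Polynomial.X ^ 2 - 1)))
    rw [hdeg, hQ2] at this
    rw [this]
    simp only [hne, ne_eq, not_false_eq_true, true_or, true_and]
  -- Both `s` and the companion point with the same `χ` are block conjugate to the slice of the
  -- diagonal matrix of roots.
  have hgen : ∀ s ∈ involutions K n p₁ m₁ p₂ m₂, MvPolynomial.eval (entries s) Ds ≠ 0 →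
      MvPolynomial.eval (entries s) E = 0 := fun s hs hD => by
    rw [hDs] at hD
    obtain ⟨x, hx, hx1, hx2, hr⟩ := exists_roots_of_separable (natDegree_blockChi s) hD
    rw [hE, sub_eq_zero, hP]
    obtain ⟨g, g', hg, hg', e⟩ := exists_conj_slice_diagonal_of_isRoot hs h1 h2 hx hx1 hx2 hr
    rw [hf s hs _ (slice_mem_involutions _) g g' hg hg' e]
    obtain ⟨g, g', hg, hg', e⟩ := exists_conj_slice_diagonal_of_isRoot
      (s := companionSlice K n p₁ m₁ p₂ m₂ fun i : Fin n => (blockChi p₁ m₁ s).coeff i)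
      (slice_mem_involutions _) h1 h2 hx hx1 hx2 (by
        rw [blockChi_companionSlice, monicOfCoeffs_coeff (monic_blockChi s) (natDegree_blockChi s)]
        exact hr)
    exact (hf _ (slice_mem_involutions _) _ (slice_mem_involutions _) g g' hg hg' e).symm
  -- The density argument needs one point of the class at which the discriminant is nonzero.
  obtain ⟨x, hx, hx1, hx2⟩ := exists_injective_ne (K := K) n
  have hsep : MvPolynomial.eval (entries (slice p₁ m₁ p₂ m₂ (diagonal x))) Ds ≠ 0 := by
    rw [hDs, blockChi_slice, charpoly_diagonal]
    have h0 : (Polynomial.X ^ 2 - 1 : K[X]) =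
        (Polynomial.X - Polynomial.C 1) * (Polynomial.X - Polynomial.C (-1)) := by
      simp only [map_one, map_neg]; ring
    have h12 : (1 : K) ≠ -1 := by
      intro h
      have : (2 : K) = 0 := by linear_combination h
      exact two_ne_zero this
    have h3 := Polynomial.separable_prod_X_sub_C_iff (F := K)
      (f := Sum.elim x ![1, -1])
    rw [Fintype.prod_sum_type, Fin.prod_univ_two] at h3
    simp only [Sum.elim_inl, Sum.elim_inr, cons_val_zero, cons_val_one] at h3
    rw [h0, h3]
    refine hx.sumElim ?_ ?_
    · intro i j h
      fin_cases i <;> fin_cases j <;> simp_all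
    · intro i j
      fin_cases j
      · exact hx1 i
      · exact hx2 i
  intro s hs
  have hmem := slice_mem_involutions (p₁ := p₁) (m₁ := m₁) (p₂ := p₂) (m₂ := m₂) (diagonal x)
  have hconj : ∀ s ∈ involutions K n p₁ m₁ p₂ m₂, ∃ g : (Matrix M M K)ˣ,
      s = g.val * slice p₁ m₁ p₂ m₂ (diagonal x) * g⁻¹.val := fun s hs =>
    exists_units_conj hs.1 hmem.1 (hs.2.trans hmem.2.symm)
  obtain ⟨g, hg⟩ := hconj s hs
  have := eval_eq_zero_of_conj (slice p₁ m₁ p₂ m₂ (diagonal x)) E Ds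
    (fun g => hgen _ (conj_mem_involutions hmem g)) ⟨1, by simpa using hsep⟩ g
  rw [← hg, hE, sub_eq_zero] at this
  exact this

end Invariants

/-! ### Splitting of `K ⊗ D` -/

section Splitting

variable {F : Type*} [Field F] {D : Type*} [DivisionRing D] [Algebra F D]

/-- An endomorphism of `D` that commutes with left and right multiplications is the
multiplication by an element of the center. -/
lemma exists_smul_of_commute [Algebra.IsCentral F D]
    (φ : End (AlgHom.mulLeftRight F D).range D) :
    ∃ c : F, ∀ x, φ x = c • x := by
  have hφ : ∀ (a b x : D), φ (a * x * b) = a * φ x * b := fun a b x => by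
    have := φ.map_smul (⟨AlgHom.mulLeftRight F D (a ⊗ₜ MulOpposite.op b), _, rfl⟩ :
      (AlgHom.mulLeftRight F D).range) x
    simpa [Subalgebra.smul_def] using! this
  have h1 : ∀ x, φ x = x * φ 1 := fun x => by simpa using hφ x 1 1
  have h2 : ∀ x, φ x = φ 1 * x := fun x => by simpa using hφ 1 x 1
  have hc : φ 1 ∈ Subalgebra.center F D := by
    rw [Subalgebra.mem_center_iff]
    intro b
    rw [← h1, ← h2]
  obtain ⟨c, hc⟩ := Algebra.mem_bot.1 (Algebra.IsCentral.out hc)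
  exact ⟨c, fun x => by rw [h2, ← hc, Algebra.smul_def]⟩

instance : IsSimpleModule (AlgHom.mulLeftRight F D).range D := by
  refine (isSimpleModule_iff_toSpanSingleton_surjective).2 ⟨inferInstance, fun x hx y => ?_⟩
  refine ⟨⟨AlgHom.mulLeftRight F D ((y * x⁻¹) ⊗ₜ MulOpposite.op 1), _, rfl⟩, ?_⟩
  simp [Subalgebra.smul_def, hx]

/-- `D` is a simple module over the algebra of left and right multiplications, and its endomorphisms
are the scalars of `F`. By Jacobson density every `F`-linear map agrees on a finite basis with an
element of that algebra. -/
lemma mulLeftRight_surjective [Algebra.IsCentral F D] [FiniteDimensional F D] :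
    Function.Surjective (AlgHom.mulLeftRight F D) := by
  classical
  intro f
  let f' : End (End (AlgHom.mulLeftRight F D).range D) D :=
    { toFun := f
      map_add' := f.map_add
      map_smul' := fun φ x => by
        obtain ⟨c, hc⟩ := exists_smul_of_commute φ
        simp [hc] }
  obtain ⟨⟨_, r, rfl⟩, hr⟩ := jacobson_density
    (R := (AlgHom.mulLeftRight F D).range) (M := D) f' (Finset.univ.image (finBasis F D))
  refine ⟨r, (finBasis F D).ext fun i => ?_⟩
  exact (hr _ (Finset.mem_image_of_mem _ (Finset.mem_univ i))).symm

variable (K : Type*) [Field K] [Algebra F K]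

lemma baseChange_mulLeftRight_mem (I : TwoSidedIdeal (K ⊗[F] D)) {x : K ⊗[F] D} (hx : x ∈ I)
    (z : D ⊗[F] Dᵐᵒᵖ) : (AlgHom.mulLeftRight F D z).baseChange K x ∈ I := by
  induction z with
  | zero => simp [I.zero_mem]
  | add a b ha hb =>
    rw [map_add, LinearMap.baseChange_add]
    exact I.add_mem ha hb
  | tmul a b =>
    have h : (AlgHom.mulLeftRight F D (a ⊗ₜ b)).baseChange K =
        LinearMap.mulLeft K ((1 : K) ⊗ₜ[F] a) ∘ₗ LinearMap.mulRight K ((1 : K) ⊗ₜ[F] b.unop) := by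
      ext y
      simp [mul_assoc]
    rw [h]
    exact I.mul_mem_left _ _ (I.mul_mem_right _ _ hx)

lemma extendForm_tmul {K : Type*} [Field K] [Algebra F K] (l : D →ₗ[F] F) (k : K) (x : D) :
    extendForm K l (k ⊗ₜ x) = l x • k := by
  simp [extendForm]

lemma extendForm_coord {K : Type*} [Field K] [Algebra F K] {ι : Type*} (b : Basis ι F D)
    (i : ι) (x : K ⊗[F] D) :
    extendForm K (b.coord i) x = (Algebra.TensorProduct.basis K b).coord i x := by
  induction x with
  | zero => simp
  | add x y hx hy => rw [map_add, map_add, hx, hy]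
  | tmul k x => simp [extendForm_tmul, Algebra.smul_def, mul_comm]

lemma exists_extendForm_ne_zero {K : Type*} [Field K] [Algebra F K] {x : K ⊗[F] D}
    (hx : x ≠ 0) : ∃ l : D →ₗ[F] F, extendForm K l x ≠ 0 := by
  by_contra! h
  refine hx ((Algebra.TensorProduct.basis K (Basis.ofVectorSpace F D)).ext_elem fun i => ?_)
  rw [map_zero, Finsupp.zero_apply, ← Basis.coord_apply, ← extendForm_coord, h]

instance isSimpleRing_tensorProduct [Algebra.IsCentral F D] [FiniteDimensional F D] :
    IsSimpleRing (K ⊗[F] D) := by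
  refine .of_eq_bot_or_eq_top fun I => or_iff_not_imp_left.2 fun hI => ?_
  obtain ⟨x, hx, hx0⟩ : ∃ x ∈ I, x ≠ 0 := by
    by_contra! h
    exact hI (le_bot_iff.1 fun x hx => (TwoSidedIdeal.mem_bot _).2 (h x hx))
  obtain ⟨l, hl⟩ := exists_extendForm_ne_zero hx0
  -- The map `y ↦ l(y) 1` is a sum of maps `y ↦ a y b`, so its base change preserves the ideal. It
  -- sends `x` to a nonzero scalar, which is a unit.
  obtain ⟨z, hz⟩ := mulLeftRight_surjective ((Algebra.linearMap F D) ∘ₗ l)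
  have h1 := baseChange_mulLeftRight_mem K I hx z
  have h2 : ∀ y, (AlgHom.mulLeftRight F D z).baseChange K y = extendForm K l y ⊗ₜ[F] (1 : D) :=
    fun y => by
    induction y with
    | zero => simp
    | add x y hx hy => rw [map_add, map_add, hx, hy, TensorProduct.add_tmul]
    | tmul k y =>
      rw [hz, LinearMap.baseChange_tmul, extendForm_tmul, TensorProduct.smul_tmul]
      simp [Algebra.algebraMap_eq_smul_one]
  rw [h2] at h1
  rw [← TwoSidedIdeal.one_mem_iff]
  have := I.mul_mem_left ((extendForm K l x)⁻¹ ⊗ₜ[F] (1 : D)) _ h1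
  rwa [Algebra.TensorProduct.tmul_mul_tmul, inv_mul_cancel₀ hl, mul_one,
    ← Algebra.TensorProduct.one_def] at this

lemma exists_algEquiv_matrix [IsAlgClosed K] [Algebra.IsCentral F D] [FiniteDimensional F D]
    {d : ℕ} (hd : finrank F D = d ^ 2) :
    Nonempty (K ⊗[F] D ≃ₐ[K] Matrix (Fin d) (Fin d) K) := by
  obtain ⟨n, -, ⟨e⟩⟩ := IsSimpleRing.exists_algEquiv_matrix_of_isAlgClosed K (K ⊗[F] D)
  have h := e.toLinearEquiv.finrank_eq
  rw [finrank_baseChange, hd, finrank_matrix] at h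
  simp only [Fintype.card_fin, finrank_self, mul_one] at h
  obtain rfl : d = n := by nlinarith
  exact ⟨e⟩

end Splitting

/-! ### Independence of the splitting -/

section ReducedCharpoly

variable {K : Type*} [Field K]

/-- Isomorphisms of matrix algebras preserve characteristic polynomials. -/
lemma charpoly_algEquiv {m m' : Type*} [Fintype m] [DecidableEq m] [Fintype m'] [DecidableEq m']
    (φ : Matrix m m K ≃ₐ[K] Matrix m' m' K) (a : Matrix m m K) :
    (φ a).charpoly = a.charpoly := by
  -- Skolem–Noether: an isomorphism of endomorphism algebras is conjugation by a linear isomorphism.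
  obtain ⟨T, hT⟩ := AlgEquiv.eq_linearEquivConjAlgEquiv
    ((toLinAlgEquiv' (R := K) (n := m)).symm.trans (φ.trans (toLinAlgEquiv' (R := K) (n := m'))))
  have := congrArg (fun f => f (toLin' a)) hT
  have h2 : toLin' (φ a) = T.conj (toLin' a) := by
    refine Eq.trans ?_ this
    change toLin' (φ a) = toLin' (φ (LinearMap.toMatrix' (toLin' a)))
    rw [LinearMap.toMatrix'_toLin']
  rw [← charpoly_toLin', h2, LinearEquiv.charpoly_conj, charpoly_toLin']

lemma reducedCharpoly_eq {A : Type*} [Ring A] [Algebra K A] {m : Type*} [Fintype m]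
    [DecidableEq m] (e : A ≃ₐ[K] Matrix m m K) (a : A) :
    reducedCharpoly K a = (e a).charpoly := by
  have h : ∃ n : ℕ, Nonempty (A ≃ₐ[K] Matrix (Fin n) (Fin n) K) :=
    ⟨Fintype.card m, ⟨e.trans (reindexAlgEquiv K K (Fintype.equivFin m))⟩⟩
  rw [reducedCharpoly, dif_pos h, ← charpoly_algEquiv (h.choose_spec.some.symm.trans e)]
  simp

end ReducedCharpoly

/-! ### From matrices over a split algebra to block matrices over `K` -/

section Transport

lemma signUnit_mul_self {A : Type*} [Ring A] (n r : ℕ) :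
    (signUnit n r : (Matrix (Fin n) (Fin n) A)ˣ) * signUnit n r = 1 :=
  Units.ext (signUnit n r).val_inv

lemma signUnit_inv {A : Type*} [Ring A] (n r : ℕ) :
    (signUnit n r : (Matrix (Fin n) (Fin n) A)ˣ)⁻¹ = signUnit n r :=
  inv_eq_of_mul_eq_one_right (signUnit_mul_self n r)

/-- Matrices over a matrix algebra as matrices over the base field. -/
def matEquiv {K A : Type*} [Field K] [Ring A] [Algebra K A] {d : ℕ}
    (e : A ≃ₐ[K] Matrix (Fin d) (Fin d) K) {m M : Type*} [Fintype m] [DecidableEq m]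
    [Fintype M] [DecidableEq M] (τ : m × Fin d ≃ M) : Matrix m m A ≃ₐ[K] Matrix M M K :=
  e.mapMatrix.trans ((compAlgEquiv m (Fin d) K K).trans (reindexAlgEquiv K K τ))

variable {K A : Type*} [Field K] [Ring A] [Algebra K A] {d : ℕ}
  (e : A ≃ₐ[K] Matrix (Fin d) (Fin d) K)

section

variable {m M : Type*} [Fintype m] [DecidableEq m] [Fintype M] [DecidableEq M]
  (τ : m × Fin d ≃ M)

lemma matEquiv_apply (x : Matrix m m A) (a b : M) :
    matEquiv e τ x a b = e (x (τ.symm a).1 (τ.symm b).1) (τ.symm a).2 (τ.symm b).2 := rfl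

lemma matEquiv_diagonal (f : m → K) :
    matEquiv e τ (diagonal fun i => algebraMap K A (f i)) =
      diagonal fun a => f (τ.symm a).1 := by
  ext a b
  rw [matEquiv_apply, diagonal_apply, diagonal_apply]
  split_ifs with h1 h2 h2
  · rw [AlgEquiv.commutes, algebraMap_matrix_apply, if_pos (by rw [h2])]
    rfl
  · rw [AlgEquiv.commutes, algebraMap_matrix_apply, if_neg]
    exact fun h3 => h2 (τ.symm.injective (Prod.ext h1 h3))
  · exact absurd (by rw [h2]) h1
  · simp

lemma trace_matEquiv (x : Matrix m m A) :
    (matEquiv e τ x).trace = ∑ i, (e (x i i)).trace := by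
  rw [trace, ← Equiv.sum_comp τ, Fintype.sum_prod_type]
  refine Finset.sum_congr rfl fun i _ => Finset.sum_congr rfl fun j _ => ?_
  simp [matEquiv_apply]

end

lemma trace_matEquiv_signUnit {N r s : ℕ} (h : r + s = N) {M : Type*} [Fintype M]
    [DecidableEq M] (τ : Fin N × Fin d ≃ M) :
    (matEquiv e τ (signUnit N r : (Matrix (Fin N) (Fin N) A)ˣ).val).trace = d * ((r : K) - s) := by
  subst h
  rw [trace_matEquiv, Fin.sum_univ_add]
  simp [signUnit]
  ring

variable {p q : ℕ} {I J : Type*} (τ₁ : Fin p × Fin d ≃ I) (τ₂ : Fin q × Fin d ≃ J)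

/-- The index equivalence for block matrices. -/
def blockIndex : Fin (p + q) × Fin d ≃ I ⊕ J :=
  (finSumFinEquiv.symm.prodCongr (Equiv.refl _)).trans
    ((Equiv.sumProdDistrib _ _ _).trans (τ₁.sumCongr τ₂))

lemma blockIndex_symm_inl (i : I) : (blockIndex τ₁ τ₂).symm (.inl i) =
    (Fin.castAdd q (τ₁.symm i).1, (τ₁.symm i).2) := rfl

lemma blockIndex_symm_inr (j : J) : (blockIndex τ₁ τ₂).symm (.inr j) =
    (Fin.natAdd p (τ₂.symm j).1, (τ₂.symm j).2) := rfl

variable [Fintype I] [DecidableEq I] [Fintype J] [DecidableEq J]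

lemma matEquiv_signUnit :
    matEquiv e (blockIndex τ₁ τ₂) (signUnit (p + q) p : (Matrix _ _ A)ˣ).val =
      fromBlocks 1 0 0 (-1) := by
  have h2 : (signUnit (p + q) p : (Matrix _ _ A)ˣ).val =
      diagonal fun i => algebraMap K A (if i.val < p then 1 else -1) :=
    congrArg diagonal (by ext i; split_ifs <;> simp)
  have h3 : (-1 : Matrix J J K) = diagonal fun _ => -1 := by rw [← diagonal_one, diagonal_neg]
  rw [h2, matEquiv_diagonal, h3, ← diagonal_one, fromBlocks_diagonal]
  congr 1
  ext (i | j)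
  · simp [blockIndex_symm_inl]
  · simp [blockIndex_symm_inr]

lemma toBlocks₁₁_matEquiv (x : Matrix (Fin (p + q)) (Fin (p + q)) A) :
    (matEquiv e (blockIndex τ₁ τ₂) x).toBlocks₁₁ =
      matEquiv e τ₁ (x.submatrix (Fin.castAdd q) (Fin.castAdd q)) := by
  ext i j
  rfl

end Transport

/-! ### `S_{p'}` as a class of involutions -/

section Component

variable {F : Type*} [Field F] {D : Type*} [DivisionRing D] [Algebra F D]
  {K : Type*} [Field K] [Algebra F K] {d : ℕ}
  (e : K ⊗[F] D ≃ₐ[K] Matrix (Fin d) (Fin d) K)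
  {p q p' q' n p₁ m₁ p₂ m₂ : ℕ}
  (τ₁ : Fin p × Fin d ≃ Idx n p₁ m₁) (τ₂ : Fin q × Fin d ≃ Idx n p₂ m₂)

/-- The involution that corresponds to a point of the symmetric space. -/
noncomputable def toInvolution (x : GLPoints F D K (p + q)) :
    Matrix (Idx n p₁ m₁ ⊕ Idx n p₂ m₂) (Idx n p₁ m₁ ⊕ Idx n p₂ m₂) K :=
  matEquiv e (blockIndex τ₁ τ₂) (x * signUnit (p + q) p).val

lemma toInvolution_mem (hpq : p' + q' = p + q)
    (htr : (d : K) * (p' - q') = p₁ - m₁ + (p₂ - m₂)) {x : GLPoints F D K (p + q)}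
    (hx : x ∈ component F D K p q p') :
    toInvolution e τ₁ τ₂ x ∈ involutions K n p₁ m₁ p₂ m₂ := by
  obtain ⟨g, rfl⟩ := hx
  have h0 : matEquiv e (blockIndex τ₁ τ₂)
      (signUnit (p + q) p' : GLPoints F D K (p + q)).val ∈ involutions K n p₁ m₁ p₂ m₂ := by
    refine ⟨?_, ?_⟩
    · rw [← map_mul, ← Units.val_mul, signUnit_mul_self, Units.val_one, map_one]
    · rw [trace_matEquiv_signUnit e hpq, htr]
  have := conj_mem_involutions h0
    (Units.map (matEquiv e (blockIndex τ₁ τ₂)).toMonoidHom g)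
  rw [toInvolution, mul_assoc _ (signUnit (p + q) p), signUnit_mul_self, mul_one, Units.val_mul,
    Units.val_mul, map_mul, map_mul]
  exact this

/-- Involutions with equal trace are conjugate, so `s` is conjugate to the image of `θ_{p'}`, and
the conjugating matrix pulls back to `G`. -/
lemma exists_toInvolution_eq [CharZero K] (hpq : p' + q' = p + q)
    (htr : (d : K) * (p' - q') = p₁ - m₁ + (p₂ - m₂))
    {s : Matrix (Idx n p₁ m₁ ⊕ Idx n p₂ m₂) (Idx n p₁ m₁ ⊕ Idx n p₂ m₂) K}
    (hs : s ∈ involutions K n p₁ m₁ p₂ m₂) :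
    ∃ x ∈ component F D K p q p', toInvolution e τ₁ τ₂ x = s := by
  obtain ⟨g, hg⟩ := exists_units_conj (K := K) hs.1
    (t := matEquiv e (blockIndex τ₁ τ₂) (signUnit (p + q) p' : GLPoints F D K (p + q)).val)
    (by rw [← map_mul, ← Units.val_mul, signUnit_mul_self, Units.val_one, map_one])
    (by rw [trace_matEquiv_signUnit e hpq, htr]; exact hs.2)
  let g' : GLPoints F D K (p + q) :=
    Units.map (matEquiv e (blockIndex τ₁ τ₂)).symm.toMonoidHom g
  refine ⟨_, ⟨g', rfl⟩, ?_⟩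
  rw [toInvolution, mul_assoc _ (signUnit (p + q) p), signUnit_mul_self, mul_one, Units.val_mul,
    Units.val_mul, map_mul, map_mul, hg]
  congr
  · exact (matEquiv e (blockIndex τ₁ τ₂)).apply_symm_apply _
  · exact (matEquiv e (blockIndex τ₁ τ₂)).apply_symm_apply _

lemma reducedCharpoly_plusBlock (x : GLPoints F D K (p + q)) :
    reducedCharpoly K (plusBlock x) = (toInvolution e τ₁ τ₂ x).toBlocks₁₁.charpoly := by
  rw [reducedCharpoly_eq (matEquiv e τ₁), toInvolution, toBlocks₁₁_matEquiv]
  congr 2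
  ext i j
  simp [plusBlock, signUnit, mul_diagonal]

lemma chi_eq_blockChi (τ₁ : Fin p × Fin d ≃ Idx n (d * (p' - q)) (d * (p - p')))
    (x : component F D K p q p') :
    chi d p q p' x = blockChi (d * (p' - q)) (d * (p - p')) (toInvolution e τ₁ τ₂ x.1) := by
  rw [chi, reducedCharpoly_plusBlock e τ₁ τ₂]
  rfl

/-- As `(x θ)² = 1`, the coordinates of `x⁻¹` are linear in those of `x θ`. Regular functions
therefore need no inverse of a determinant. -/
lemma inv_eq_of_mem_component {x : GLPoints F D K (p + q)} (hx : x ∈ component F D K p q p') :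
    x⁻¹ = signUnit (p + q) p * (x * signUnit (p + q) p) := by
  obtain ⟨g, rfl⟩ := hx
  rw [mul_assoc _ (signUnit (p + q) p) (signUnit (p + q) p), signUnit_mul_self, mul_one]
  simp only [_root_.mul_inv_rev, inv_inv, signUnit_inv, mul_assoc]

lemma exists_eval_entries_eq {M : Type*} [Fintype M] [DecidableEq M]
    (L : Matrix M M K →ₗ[K] K) : ∃ P : MvPolynomial (M × M) K, ∀ s,
      MvPolynomial.eval (entries s) P = L s := by
  refine ⟨∑ i, ∑ j, MvPolynomial.C (L (single i j 1)) * MvPolynomial.X (i, j), fun s => ?_⟩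
  conv_rhs => rw [matrix_eq_sum_single s]
  simp only [map_sum, map_mul, MvPolynomial.eval_C, MvPolynomial.eval_X, entries]
  refine Finset.sum_congr rfl fun i _ => Finset.sum_congr rfl fun j _ => ?_
  rw [mul_comm, ← smul_eq_mul, ← map_smul, smul_single, smul_eq_mul, mul_one]

lemma val_eq_of_toInvolution (x : GLPoints F D K (p + q)) :
    (x * signUnit (p + q) p).val =
      (matEquiv e (blockIndex τ₁ τ₂)).symm (toInvolution e τ₁ τ₂ x) := by
  rw [toInvolution, AlgEquiv.symm_apply_apply]

/-- Regular functions are polynomials in the entries of the corresponding involution. -/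
lemma exists_eval_toInvolution (f : regularFunctions F D (component F D K p q p')) :
    ∃ P : MvPolynomial
      ((Idx n p₁ m₁ ⊕ Idx n p₂ m₂) × (Idx n p₁ m₁ ⊕ Idx n p₂ m₂)) K, ∀ x,
      f.1 x = MvPolynomial.eval (entries (toInvolution e τ₁ τ₂ x.1)) P := by
  obtain ⟨f, hf⟩ := f
  let A := Matrix (Fin (p + q)) (Fin (p + q)) (K ⊗[F] D)
  let ent : (D →ₗ[F] F) → Fin (p + q) → Fin (p + q) → A →ₗ[K] K := fun l i j =>
    extendForm K l ∘ₗ entryLinearMap K (K ⊗[F] D) i j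
  let Φ := (matEquiv e (blockIndex τ₁ τ₂)).symm.toLinearMap
  change ∃ P, ∀ x, f x = _
  induction hf using Algebra.adjoin_induction with
  | mem f hf =>
    rcases hf with ⟨l, i, j, rfl⟩ | ⟨l, i, j, rfl⟩
    · obtain ⟨P, hP⟩ := exists_eval_entries_eq (ent l i j ∘ₗ
        LinearMap.mulRight K (signUnit (p + q) p : GLPoints F D K (p + q)).val ∘ₗ Φ)
      refine ⟨P, fun x => ?_⟩
      have : x.1.val = Φ (toInvolution e τ₁ τ₂ x.1) *
          (signUnit (p + q) p : GLPoints F D K (p + q)).val := by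
        have := val_eq_of_toInvolution e τ₁ τ₂ x.1
        change _ = (matEquiv e (blockIndex τ₁ τ₂)).symm _ * _
        rw [← this, ← Units.val_mul, mul_assoc, signUnit_mul_self, mul_one]
      rw [hP]
      change extendForm K l (x.1.val i j) = _
      rw [this]
      rfl
    · obtain ⟨P, hP⟩ := exists_eval_entries_eq (ent l i j ∘ₗ
        LinearMap.mulLeft K (signUnit (p + q) p : GLPoints F D K (p + q)).val ∘ₗ Φ)
      refine ⟨P, fun x => ?_⟩
      have : x.1⁻¹.val = (signUnit (p + q) p : GLPoints F D K (p + q)).val *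
          Φ (toInvolution e τ₁ τ₂ x.1) := by
        have := val_eq_of_toInvolution e τ₁ τ₂ x.1
        change _ = _ * (matEquiv e (blockIndex τ₁ τ₂)).symm _
        rw [← this, ← Units.val_mul, inv_eq_of_mem_component x.2]
      rw [hP]
      change extendForm K l (x.1⁻¹.val i j) = _
      rw [this]
      rfl
  | algebraMap r =>
    exact ⟨MvPolynomial.C (algebraMap F K r), fun x => by simp⟩
  | add f g _ _ hf hg =>
    obtain ⟨P, hP⟩ := hf
    obtain ⟨Q, hQ⟩ := hg
    exact ⟨P + Q, fun x => by rw [map_add, ← hP, ← hQ]; rfl⟩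
  | mul f g _ _ hf hg =>
    obtain ⟨P, hP⟩ := hf
    obtain ⟨Q, hQ⟩ := hg
    exact ⟨P * Q, fun x => by rw [map_mul, ← hP, ← hQ]; rfl⟩

/-- Block diagonal matrices commute with the image `(1, -1)` of `θ`, so they come from `G^θ`; both
involutions come from points of `S_{p'}`. -/
lemma isBlockInvariant_of_mem_invariants [CharZero K] (hpq : p' + q' = p + q)
    (htr : (d : K) * (p' - q') = p₁ - m₁ + (p₂ - m₂))
    {f : regularFunctions F D (component F D K p q p')} (hf : f ∈ invariants F D K p q p')
    {P : MvPolynomial ((Idx n p₁ m₁ ⊕ Idx n p₂ m₂) × (Idx n p₁ m₁ ⊕ Idx n p₂ m₂)) K}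
    (hP : ∀ x, f.1 x = MvPolynomial.eval (entries (toInvolution e τ₁ τ₂ x.1)) P) :
    IsBlockInvariant P := by
  intro s hs s' hs' g h hg hh hsg
  obtain ⟨x, hx, rfl⟩ := exists_toInvolution_eq (F := F) (D := D) e τ₁ τ₂ hpq htr hs
  obtain ⟨x', hx', rfl⟩ := exists_toInvolution_eq (F := F) (D := D) e τ₁ τ₂ hpq htr hs'
  have hG : IsUnit (fromBlocks g 0 0 h) := by
    rw [isUnit_iff_isUnit_det, det_fromBlocks_zero₁₂]
    exact ((isUnit_iff_isUnit_det _).1 hg).mul ((isUnit_iff_isUnit_det _).1 hh)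
  obtain ⟨u, hu⟩ := hG
  let η : GLPoints F D K (p + q) :=
    Units.map (matEquiv e (blockIndex τ₁ τ₂)).symm.toMonoidHom u
  have hη : matEquiv e (blockIndex τ₁ τ₂) η.val = fromBlocks g 0 0 h := by
    rw [← hu]; exact (matEquiv e (blockIndex τ₁ τ₂)).apply_symm_apply _
  have hcomm : signUnit (p + q) p * η = η * signUnit (p + q) p := by
    apply Units.ext
    apply (matEquiv e (blockIndex τ₁ τ₂)).injective
    rw [Units.val_mul, Units.val_mul, map_mul, map_mul, hη, matEquiv_signUnit, fromBlocks_multiply,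
      fromBlocks_multiply]
    simp
  have hmem : η⁻¹ ∈ centralizerTheta F D K p q :=
    inv_mem (Subgroup.mem_centralizer_iff.2 fun y hy => by
      rw [Set.mem_singleton_iff.1 hy]; exact hcomm)
  have hxx : x * η = η * x' := by
    have h1 : x * signUnit (p + q) p * η = η * (x' * signUnit (p + q) p) := by
      apply Units.ext
      apply (matEquiv e (blockIndex τ₁ τ₂)).injective
      rw [Units.val_mul _ η, Units.val_mul η, map_mul, map_mul, hη]
      exact hsg
    rw [mul_assoc, hcomm, ← mul_assoc, ← mul_assoc] at h1
    exact mul_right_cancel h1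
  have := hf ⟨η⁻¹, hmem⟩ ⟨x, hx⟩
  rw [← hP ⟨x, hx⟩, ← hP ⟨x', hx'⟩, ← this]
  refine congrArg f.1 (Subtype.ext ?_)
  simp only [conj, inv_inv]
  rw [mul_assoc, hxx, inv_mul_cancel_left]

end Component

/-! ### Galois descent for functions and polynomials -/

section Descent

variable {F K : Type*} [Field F] [Field K] [Algebra F K]

/-- Finitely many elements of a Galois extension have traces from a common finite set of
automorphisms. -/
lemma exists_finset_sum_mem_range [IsGalois F K] {ι : Type*} [Finite ι] (k : ι → K) :
    ∃ s : Finset (K ≃ₐ[F] K), s.Nonempty ∧ ∀ j, ∃ t : F, ∑ σ ∈ s, σ (k j) = algebraMap F K t := by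
  classical
  let L := (FiniteGaloisIntermediateField.adjoin F (Set.range k)).toIntermediateField
  have hk : ∀ j, k j ∈ L := fun j =>
    FiniteGaloisIntermediateField.subset_adjoin F (Set.range k) ⟨j, rfl⟩
  have hinj : Function.Injective fun σ : L ≃ₐ[F] L => σ.liftNormal K := fun σ τ h => by
    ext x
    have := AlgEquiv.liftNormal_commutes σ K x
    dsimp only at h
    rw [h, AlgEquiv.liftNormal_commutes τ K x] at this
    exact congrArg Subtype.val ((algebraMap L K).injective this.symm)
  -- One lift to `K` of each automorphism of a finite Galois extension `L` containing all `k j`; the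
  -- sum is then the trace from `L` to `F`.
  refine ⟨Finset.univ.map ⟨_, hinj⟩, by simp, fun j => ⟨Algebra.trace F L ⟨k j, hk j⟩, ?_⟩⟩
  rw [IsScalarTower.algebraMap_apply F L K, trace_eq_sum_automorphisms, map_sum, Finset.sum_map]
  exact Finset.sum_congr rfl fun σ _ => AlgEquiv.liftNormal_commutes σ K ⟨k j, hk j⟩

/-- Galois descent for algebras of functions: an equivariant function in the `K`-algebra
generated by a subalgebra of equivariant functions belongs to the subalgebra. -/
lemma mem_of_mem_adjoin_of_equivariant [CharZero F] [IsGalois F K] {X : Type*}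
    (ρ : (K ≃ₐ[F] K) → X → X) (R : Subalgebra F (X → K))
    (hR : ∀ f ∈ R, ∀ σ x, f (ρ σ x) = σ (f x)) {g : X → K}
    (hg : g ∈ Algebra.adjoin K (R : Set (X → K))) (hgρ : ∀ σ x, g (ρ σ x) = σ (g x)) :
    g ∈ R := by
  have hc : Submonoid.closure (R : Set (X → K)) = R.toSubmonoid :=
    Submonoid.closure_eq R.toSubmonoid
  rw [← Subalgebra.mem_toSubmodule, Algebra.adjoin_eq_span, hc] at hg
  obtain ⟨n, k, f, rfl⟩ := Submodule.mem_span_set'.1 hg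
  obtain ⟨s, hs, hsum⟩ := exists_finset_sum_mem_range (F := F) k
  choose t ht using hsum
  have hcard : (s.card : F) ≠ 0 := by exact_mod_cast hs.card_pos.ne'
  -- Equivariance lets `σ` act on the coefficients `k i` without changing the function. Averaging
  -- over `s` replaces them by elements of `F`.
  have hsurj : ∀ (σ : K ≃ₐ[F] K) x, (∑ i, k i • (f i : X → K)) x = ∑ i, σ (k i) * (f i : X → K) x := by
    intro σ x
    have h1 := hgρ σ⁻¹ x
    have h2 : σ ((∑ i, k i • (f i : X → K)) (ρ σ⁻¹ x)) = (∑ i, k i • (f i : X → K)) x := by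
      rw [h1]; exact σ.apply_symm_apply _
    rw [← h2]
    simp only [Finset.sum_apply, Pi.smul_apply, smul_eq_mul, map_sum, map_mul]
    refine Finset.sum_congr rfl fun i _ => ?_
    rw [hR _ (f i).2]
    congr 1
    exact σ.apply_symm_apply _
  have : ∑ i, k i • (f i : X → K) = (s.card : F)⁻¹ • ∑ i, t i • (f i : X → K) := by
    rw [eq_inv_smul_iff₀ hcard]
    ext x
    have h3 : ∑ σ ∈ s, (∑ i, k i • (f i : X → K)) x =
        ∑ σ ∈ s, ∑ i, σ (k i) * (f i : X → K) x := Finset.sum_congr rfl fun σ _ => hsurj σ x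
    rw [Finset.sum_const, Finset.sum_comm] at h3
    rw [Pi.smul_apply, Algebra.smul_def, map_natCast, ← nsmul_eq_mul, h3, Finset.sum_apply]
    refine Finset.sum_congr rfl fun i _ => ?_
    rw [← Finset.sum_mul, ht, Pi.smul_apply, Algebra.smul_def]
  rw [this]
  exact R.smul_mem (R.sum_mem fun i _ => R.smul_mem (f i).2 _) _

/-- Polynomials fixed by the Galois group have coefficients in the base field. -/
lemma exists_map_eq_of_forall_map_eq [IsGalois F K] {ι : Type*} {P : MvPolynomial ι K}
    (h : ∀ σ : K ≃ₐ[F] K, MvPolynomial.map (σ : K →+* K) P = P) :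
    ∃ Q : MvPolynomial ι F, MvPolynomial.map (algebraMap F K) Q = P := by
  change P ∈ Set.range (MvPolynomial.map (algebraMap F K))
  rw [MvPolynomial.mem_range_map_iff_coeffs_subset]
  intro c hc
  obtain ⟨m, -, rfl⟩ := MvPolynomial.mem_coeffs_iff.1 hc
  rw [InfiniteGalois.mem_range_algebraMap_iff_fixed]
  intro σ
  conv_rhs => rw [← h σ, MvPolynomial.coeff_map]
  rfl

end Descent

/-! ### Galois equivariance and `G^θ`-invariance of `χ` -/

section Galois

variable {F : Type*} [Field F] {D : Type*} [DivisionRing D] [Algebra F D]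
  {K : Type*} [Field K] [Algebra F K]

/-- The action of the Galois group on `K ⊗ D`. -/
noncomputable def galTensor (σ : K ≃ₐ[F] K) : K ⊗[F] D ≃ₐ[F] K ⊗[F] D :=
  Algebra.TensorProduct.congr σ AlgEquiv.refl

lemma galTensor_tmul (σ : K ≃ₐ[F] K) (k : K) (x : D) :
    galTensor σ (k ⊗ₜ[F] x) = σ k ⊗ₜ x := rfl

lemma extendForm_galTensor (σ : K ≃ₐ[F] K) (l : D →ₗ[F] F) (x : K ⊗[F] D) :
    extendForm K l (galTensor σ x) = σ (extendForm K l x) := by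
  induction x with
  | zero => simp
  | add x y hx hy => simp only [map_add, hx, hy]
  | tmul k x => rw [galTensor_tmul, extendForm_tmul, extendForm_tmul, map_smul]

/-- The action of the Galois group on matrices. -/
noncomputable def galMatrix (σ : K ≃ₐ[F] K) {m : Type*} [Fintype m] [DecidableEq m] :
    Matrix m m (K ⊗[F] D) ≃ₐ[F] Matrix m m (K ⊗[F] D) :=
  (galTensor σ).mapMatrix

lemma galMatrix_apply (σ : K ≃ₐ[F] K) {m : Type*} [Fintype m] [DecidableEq m]
    (x : Matrix m m (K ⊗[F] D)) (i j : m) : galMatrix σ x i j = galTensor σ (x i j) := rfl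

/-- The action of the Galois group on the geometric points of `GL_n(D)`. -/
noncomputable def galPoints (σ : K ≃ₐ[F] K) {n : ℕ} : GLPoints F D K n →* GLPoints F D K n :=
  Units.map (galMatrix σ).toMonoidHom

lemma galPoints_val (σ : K ≃ₐ[F] K) {n : ℕ} (g : GLPoints F D K n) :
    (galPoints σ g).val = galMatrix σ g.val := rfl

lemma galPoints_signUnit (σ : K ≃ₐ[F] K) (n r : ℕ) :
    galPoints σ (signUnit n r : GLPoints F D K n) = signUnit n r := by
  apply Units.ext
  ext i j
  rw [galPoints_val, galMatrix_apply]
  simp only [signUnit, diagonal_apply]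
  split_ifs <;> simp

/-- The action of the Galois group on the geometric points of `S_{p'}`. -/
noncomputable def galComponent {p q p' : ℕ} (σ : K ≃ₐ[F] K) (x : component F D K p q p') :
    component F D K p q p' :=
  ⟨galPoints σ x.1, by
    obtain ⟨_, g, rfl⟩ := x
    refine ⟨galPoints σ g, ?_⟩
    rw [map_mul, map_mul, map_mul, galPoints_signUnit, galPoints_signUnit, map_inv]⟩

lemma regularFunctions_galComponent {p q p' : ℕ} {f : component F D K p q p' → K}
    (hf : f ∈ regularFunctions F D (component F D K p q p')) (σ : K ≃ₐ[F] K)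
    (x : component F D K p q p') : f (galComponent σ x) = σ (f x) := by
  induction hf using Algebra.adjoin_induction with
  | mem f hf =>
    rcases hf with ⟨l, i, j, rfl⟩ | ⟨l, i, j, rfl⟩
    · exact extendForm_galTensor σ l _
    · change extendForm K l ((galPoints σ x.1)⁻¹.val i j) = _
      rw [← map_inv]
      exact extendForm_galTensor σ l _
  | algebraMap r => exact (σ.commutes r).symm
  | add f g _ _ hf hg => exact (congrArg₂ (· + ·) hf hg).trans (map_add σ _ _).symm
  | mul f g _ _ hf hg => exact (congrArg₂ (· * ·) hf hg).trans (map_mul σ _ _).symm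

lemma galTensor_smul (σ : K ≃ₐ[F] K) (k : K) (x : K ⊗[F] D) :
    galTensor σ (k • x) = σ k • galTensor σ x := by
  induction x with
  | zero => simp
  | add x y hx hy => simp only [smul_add, map_add, hx, hy]
  | tmul l x => simp [TensorProduct.smul_tmul', galTensor_tmul]

/-- The conjugate of a splitting by an automorphism. -/
noncomputable def galConj (σ : K ≃ₐ[F] K) {d : ℕ} (e : K ⊗[F] D ≃ₐ[K] Matrix (Fin d) (Fin d) K) :
    K ⊗[F] D ≃ₐ[K] Matrix (Fin d) (Fin d) K :=
  AlgEquiv.ofRingEquiv (f := (galTensor σ).symm.toRingEquiv.trans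
    (e.toRingEquiv.trans σ.toRingEquiv.mapMatrix)) fun k => by
      have h : (galTensor σ).symm (algebraMap K (K ⊗[F] D) k) =
          algebraMap K (K ⊗[F] D) (σ.symm k) := by
        rw [AlgEquiv.symm_apply_eq, Algebra.algebraMap_eq_smul_one,
          Algebra.algebraMap_eq_smul_one, galTensor_smul, map_one, AlgEquiv.apply_symm_apply]
      change (e ((galTensor σ).symm (algebraMap K (K ⊗[F] D) k))).map σ = _
      rw [h, AlgEquiv.commutes]
      ext i j
      simp only [map_apply, algebraMap_matrix_apply]
      split_ifs <;> simp

lemma galConj_galTensor (σ : K ≃ₐ[F] K) {d : ℕ} (e : K ⊗[F] D ≃ₐ[K] Matrix (Fin d) (Fin d) K)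
    (x : K ⊗[F] D) : galConj σ e (galTensor σ x) = (e x).map σ := by
  change (e ((galTensor σ).symm (galTensor σ x))).map σ = _
  rw [AlgEquiv.symm_apply_apply]

/-- The right side uses the splitting `e`, the left side its conjugate by `σ`, which is again
`K`-linear; the choice of splitting does not matter. -/
lemma reducedCharpoly_galMatrix (σ : K ≃ₐ[F] K) {d p : ℕ}
    (e : K ⊗[F] D ≃ₐ[K] Matrix (Fin d) (Fin d) K)
    (y : Matrix (Fin p) (Fin p) (K ⊗[F] D)) :
    reducedCharpoly K (galMatrix σ y) = (reducedCharpoly K y).map (σ : K →+* K) := by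
  rw [reducedCharpoly_eq (matEquiv e (Equiv.refl _)) y,
    reducedCharpoly_eq (matEquiv (galConj σ e) (Equiv.refl _)) (galMatrix σ y), ← charpoly_map]
  congr 1
  ext a b
  rw [matEquiv_apply, galMatrix_apply, galConj_galTensor]
  rfl

lemma chi_galComponent (σ : K ≃ₐ[F] K) {d p q p' : ℕ}
    (e : K ⊗[F] D ≃ₐ[K] Matrix (Fin d) (Fin d) K) (x : component F D K p q p') :
    chi d p q p' (galComponent σ x) = (chi d p q p' x).map (σ : K →+* K) := by
  have h : divisor K d p q p' = signPoly K (d * (p' - q)) (d * (p - p')) := rfl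
  rw [chi, chi, h, Polynomial.map_divByMonic _ (monic_signPoly _ _), signPoly_map,
    ← reducedCharpoly_galMatrix σ e]
  rfl

lemma eq_zero_of_commute_fromBlocks [CharZero K] {I J : Type*} [Fintype I] [DecidableEq I]
    [Fintype J] [DecidableEq J] {G : Matrix (I ⊕ J) (I ⊕ J) K}
    (hG : fromBlocks 1 0 0 (-1) * G = G * fromBlocks 1 0 0 (-1)) :
    G.toBlocks₁₂ = 0 ∧ G.toBlocks₂₁ = 0 := by
  rw [← fromBlocks_toBlocks G, fromBlocks_multiply, fromBlocks_multiply, fromBlocks_inj] at hG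
  obtain ⟨-, h1, h2, -⟩ := hG
  simp only [Matrix.one_mul, Matrix.mul_zero, Matrix.zero_mul, add_zero, zero_add, Matrix.mul_neg,
    Matrix.neg_mul, Matrix.mul_one] at h1 h2
  have h : ∀ x : K, x = -x → x = 0 := fun x hx => by
    have : 2 * x = 0 := by linear_combination hx
    exact (mul_eq_zero.1 this).resolve_left two_ne_zero
  exact ⟨by ext i j; exact h _ (congrFun (congrFun h1 i) j),
    by ext i j; exact h _ (congrFun (congrFun h2 i) j).symm⟩

/-- Matrices commuting with `(1, -1)` are block diagonal, so the upper left block of `s` is merely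
conjugated. -/
lemma charpoly_toBlocks₁₁_conj [CharZero K] {I J : Type*} [Fintype I] [DecidableEq I]
    [Fintype J] [DecidableEq J] {G G' : Matrix (I ⊕ J) (I ⊕ J) K} (s : Matrix (I ⊕ J) (I ⊕ J) K)
    (hG : fromBlocks 1 0 0 (-1) * G = G * fromBlocks 1 0 0 (-1))
    (hG' : fromBlocks 1 0 0 (-1) * G' = G' * fromBlocks 1 0 0 (-1)) (h : G' * G = 1) :
    (G * s * G').toBlocks₁₁.charpoly = s.toBlocks₁₁.charpoly := by
  obtain ⟨h1, h2⟩ := eq_zero_of_commute_fromBlocks hG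
  obtain ⟨h1', h2'⟩ := eq_zero_of_commute_fromBlocks hG'
  rw [← fromBlocks_toBlocks G, ← fromBlocks_toBlocks G', h1, h2, h1', h2', fromBlocks_multiply,
    ← fromBlocks_one, fromBlocks_inj] at h
  have hinv := h.1
  rw [Matrix.zero_mul, add_zero] at hinv
  conv_lhs => rw [← fromBlocks_toBlocks G, ← fromBlocks_toBlocks G', ← fromBlocks_toBlocks s, h1,
    h2, h1', h2', fromBlocks_multiply, fromBlocks_multiply, toBlocks_fromBlocks₁₁]
  simp only [Matrix.zero_mul, Matrix.mul_zero, add_zero]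
  rw [charpoly_mul_comm, ← mul_assoc, hinv, one_mul]

lemma chi_conj [CharZero K] {d p q p' : ℕ} (e : K ⊗[F] D ≃ₐ[K] Matrix (Fin d) (Fin d) K)
    (h : centralizerTheta F D K p q) (x : component F D K p q p') :
    chi d p q p' (conj h x) = chi d p q p' x := by
  have key : ∀ y : GLPoints F D K (p + q), reducedCharpoly K (plusBlock y) =
      (matEquiv e (blockIndex (Equiv.refl (Fin p × Fin d)) (Equiv.refl (Fin q × Fin d)))
        y.val).toBlocks₁₁.charpoly := fun y => by
    rw [reducedCharpoly_eq (matEquiv e (Equiv.refl _)), toBlocks₁₁_matEquiv]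
    rfl
  have hcomm : ∀ g ∈ centralizerTheta F D K p q, fromBlocks 1 0 0 (-1) *
      matEquiv e (blockIndex (Equiv.refl (Fin p × Fin d)) (Equiv.refl (Fin q × Fin d))) g.val =
      matEquiv e (blockIndex (Equiv.refl _) (Equiv.refl _)) g.val * fromBlocks 1 0 0 (-1) :=
    fun g hg => by
    rw [← matEquiv_signUnit e, ← map_mul, ← map_mul, ← Units.val_mul, ← Units.val_mul]
    congr 2
    exact Subgroup.mem_centralizer_iff.1 hg _ rfl
  rw [chi, chi, key, key]
  congr 1
  rw [conj, Units.val_mul, Units.val_mul, map_mul, map_mul]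
  refine charpoly_toBlocks₁₁_conj _ (hcomm _ h.2) (hcomm _ (inv_mem h.2)) ?_
  rw [← map_mul, Units.inv_mul, map_one]

end Galois

/-! ### Regularity over `F` of the coefficients of `χ` -/

section Quotient

variable {F : Type*} [Field F] {D : Type*} [DivisionRing D] [Algebra F D]
  {K : Type*} [Field K] [Algebra F K]

/-- `K`-linear forms are combinations of the extensions of `F`-linear forms. -/
lemma linearForm_eq_sum_extendForm {ι : Type*} [Fintype ι] (b : Basis ι F D)
    (L : K ⊗[F] D →ₗ[K] K) (x : K ⊗[F] D) :
    L x = ∑ i, L (1 ⊗ₜ b i) * extendForm K (b.coord i) x := by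
  conv_lhs => rw [← (Algebra.TensorProduct.basis K b).sum_repr x]
  rw [map_sum]
  refine Finset.sum_congr rfl fun i _ => ?_
  rw [map_smul, smul_eq_mul, mul_comm, Algebra.TensorProduct.basis_apply, extendForm_coord]
  rfl

variable [FiniteDimensional F D]

lemma linearForm_mem_adjoin {p q p' : ℕ} (L : K ⊗[F] D →ₗ[K] K) (i j : Fin (p + q)) :
    (fun x : component F D K p q p' => L (x.1.val i j)) ∈
      Algebra.adjoin K (regularFunctions F D (component F D K p q p') :
        Set (component F D K p q p' → K)) := by
  have : (fun x : component F D K p q p' => L (x.1.val i j)) =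
      ∑ k, L (1 ⊗ₜ finBasis F D k) •
        fun x : component F D K p q p' => extendForm K ((finBasis F D).coord k) (x.1.val i j) := by
    ext x
    rw [linearForm_eq_sum_extendForm (finBasis F D) L, Finset.sum_apply]
    rfl
  rw [this]
  refine Subalgebra.sum_mem _ fun k _ => Subalgebra.smul_mem _ (Algebra.subset_adjoin ?_) _
  exact Algebra.subset_adjoin (R := F) (Or.inl ⟨(finBasis F D).coord k, i, j, rfl⟩)

lemma eval_plusBlock_mem_adjoin {d p q p' : ℕ}
    (e : K ⊗[F] D ≃ₐ[K] Matrix (Fin d) (Fin d) K) (P : MvPolynomial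
      ((Fin p × Fin d) × (Fin p × Fin d)) K) :
    (fun x : component F D K p q p' => MvPolynomial.eval
      (entries (matEquiv e (Equiv.refl (Fin p × Fin d)) (plusBlock x.1))) P) ∈
      Algebra.adjoin K (regularFunctions F D (component F D K p q p') :
        Set (component F D K p q p' → K)) := by
  induction P using MvPolynomial.induction_on with
  | C a =>
    simp only [MvPolynomial.eval_C]
    exact Subalgebra.algebraMap_mem (Algebra.adjoin K _) a
  | add P Q hP hQ =>
    simp only [map_add]
    exact Subalgebra.add_mem _ hP hQ
  | mul_X P a hP =>
    have := linearForm_mem_adjoin (F := F) (p := p) (q := q) (p' := p')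
      (entryLinearMap K K a.1.2 a.2.2 ∘ₗ e.toLinearMap)
      (Fin.castAdd q a.1.1) (Fin.castAdd q a.2.1)
    have h2 := Subalgebra.mul_mem _ hP this
    convert h2 using 1
    ext x
    rw [map_mul, MvPolynomial.eval_X]
    rfl

/-- The coefficients of `χ_x` are regular functions of `x` defined over `F`. -/
lemma chi_coeff_mem_regularFunctions [CharZero F] [IsAlgClosure F K] {d p q p' : ℕ}
    (e : K ⊗[F] D ≃ₐ[K] Matrix (Fin d) (Fin d) K) (i : ℕ) :
    (fun x : component F D K p q p' => (chi d p q p' x).coeff i) ∈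
      regularFunctions F D (component F D K p q p') := by
  -- Two facts suffice: the coefficient is a polynomial over `K` in the coordinates, and it is
  -- Galois equivariant.
  refine mem_of_mem_adjoin_of_equivariant galComponent _
    (fun f hf σ x => regularFunctions_galComponent hf σ x) ?_ fun σ x => ?_
  · have := eval_plusBlock_mem_adjoin (F := F) (q := q) (p' := p') e
      (((mvPolynomialX (Fin p × Fin d) (Fin p × Fin d) K).charpoly /ₘ
        signPoly _ (d * (p' - q)) (d * (p - p'))).coeff i)
    convert this using 1
    ext x
    rw [chi, reducedCharpoly_eq (matEquiv e (Equiv.refl _)), ← Polynomial.coeff_map,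
      Polynomial.map_divByMonic _ (monic_signPoly _ _), signPoly_map, ← charpoly_map]
    congr 3
    exact (mvPolynomialX_mapMatrix_eval _).symm
  · rw [chi_galComponent σ e, Polynomial.coeff_map]
    rfl

end Quotient

end SymSpace

/-! ### The categorical quotient -/

open SymSpace

theorem proposition3p1 {F : Type*} [Field F] [CharZero F]
    {D : Type*} [DivisionRing D] [Algebra F D] [Algebra.IsCentral F D] [FiniteDimensional F D]
    (K : Type*) [Field K] [Algebra F K] [IsAlgClosure F K]
    (d : ℕ) (hd : Module.finrank F D = d ^ 2)
    (p q p' q' : ℕ) (hpq : p' + q' = p + q) (ν : ℕ) (hν : ν = min (min p q) (min p' q')) :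
    (∀ x : SymSpace.component F D K p q p',
      SymSpace.divisor K d p q p' ∣ SymSpace.reducedCharpoly K (SymSpace.plusBlock x.1) ∧
        (SymSpace.chi d p q p' x).Monic ∧ (SymSpace.chi d p q p' x).natDegree = d * ν) ∧
    ∃ c : MvPolynomial (Fin (d * ν)) F →ₐ[F]
        SymSpace.regularFunctions F D (SymSpace.component F D K p q p'),
      (∀ (i : Fin (d * ν)) (x : SymSpace.component F D K p q p'),
        (c (MvPolynomial.X i)).1 x = (SymSpace.chi d p q p' x).coeff i) ∧
      SymSpace.IsCategoricalQuotient.{w} F D K p q p' c ∧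
      Function.Injective c ∧ c.range = SymSpace.invariants F D K p q p' := by
  have : CharZero K := charZero_of_injective_algebraMap (algebraMap F K).injective
  have : IsAlgClosed K := IsAlgClosure.isAlgClosed F
  obtain ⟨e⟩ := exists_algEquiv_matrix (F := F) (D := D) K hd
  -- After scaling by `d`, these are the block sizes `n + p₁ + m₁` and `n + p₂ + m₂`. Since `p' + q'
  -- = p + q`, one of `p₁`, `m₂` vanishes, and so does one of `m₁`, `p₂`.
  have hp : p = ν + ((p' - q) + (p - p')) := by omega
  have hq : q = ν + ((p' - p) + (q' - p)) := by omega
  have hcard : ∀ r a b : ℕ, r = ν + (a + b) →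
      Nonempty (Fin r × Fin d ≃ Idx (d * ν) (d * a) (d * b)) := fun r a b h => by
    refine ⟨Fintype.equivOfCardEq ?_⟩
    simp only [Fintype.card_prod, Fintype.card_sum, Fintype.card_fin, h]
    ring
  obtain ⟨τ₁⟩ := hcard _ _ _ hp
  obtain ⟨τ₂⟩ := hcard _ _ _ hq
  have h1 : d * (p' - q) = 0 ∨ d * (q' - p) = 0 := by
    rcases (by omega : p' - q = 0 ∨ q' - p = 0) with h | h <;> simp [h]
  have h2 : d * (p - p') = 0 ∨ d * (p' - p) = 0 := by
    rcases (by omega : p - p' = 0 ∨ p' - p = 0) with h | h <;> simp [h]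
  have htr : (d : K) * (p' - q') = (d * (p' - q) : ℕ) - (d * (p - p') : ℕ) +
      ((d * (p' - p) : ℕ) - (d * (q' - p) : ℕ)) := by
    have h3 : p' + ((p - p') + (q' - p)) = q' + ((p' - q) + (p' - p)) := by omega
    have h4 := congrArg (Nat.cast (R := K)) h3
    push_cast at h4 ⊢
    linear_combination (d : K) * h4
  have hmem := fun x : component F D K p q p' => toInvolution_mem e τ₁ τ₂ hpq htr x.2
  have hchi := chi_eq_blockChi (p' := p') e τ₂ τ₁
  have hsurj : ∀ k : Fin (d * ν) → K, ∃ x : component F D K p q p',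
      (fun i : Fin (d * ν) => (chi d p q p' x).coeff i) = k := fun k => by
    obtain ⟨x, hx, hxs⟩ := exists_toInvolution_eq (F := F) (D := D) e τ₁ τ₂ hpq htr
      (slice_mem_involutions ((companion K (d * ν)).map (MvPolynomial.eval k)))
    refine ⟨⟨x, hx⟩, funext fun i => ?_⟩
    rw [hchi, hxs, blockChi_slice, charpoly_companion_map_eval, coeff_monicOfCoeffs]
  refine ⟨fun x => ⟨?_, ?_, ?_⟩, ?_⟩
  · rw [reducedCharpoly_plusBlock e τ₁ τ₂]
    exact signPoly_dvd_charpoly (hmem x) h1 h2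
  · rw [hchi]
    exact monic_blockChi _
  · rw [hchi]
    exact natDegree_blockChi _
  let c : MvPolynomial (Fin (d * ν)) F →ₐ[F] regularFunctions F D (component F D K p q p') :=
    MvPolynomial.aeval fun i : Fin (d * ν) =>
      ⟨fun x => (chi d p q p' x).coeff i, chi_coeff_mem_regularFunctions e i⟩
  have hc : ∀ P x, (c P).1 x = MvPolynomial.eval
      (fun i : Fin (d * ν) => (chi d p q p' x).coeff i)
      (MvPolynomial.map (algebraMap F K) P) := fun P x => by
    induction P using MvPolynomial.induction_on with
    | C a => simp [c]
    | add P Q hP hQ => rw [map_add, map_add, map_add, ← hP, ← hQ]; rfl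
    | mul_X P i hP =>
      rw [map_mul, map_mul, map_mul, ← hP, MvPolynomial.map_X, MvPolynomial.eval_X]
      simp only [c, MvPolynomial.aeval_X]
      rfl
  have hinj : Function.Injective c := by
    rw [injective_iff_map_eq_zero]
    intro P hP
    apply MvPolynomial.map_injective _ (algebraMap F K).injective
    rw [map_zero]
    refine MvPolynomial.funext fun k => ?_
    obtain ⟨x, rfl⟩ := hsurj k
    rw [← hc, hP, map_zero]
    rfl
  have hrange : c.range = invariants F D K p q p' := by
    ext f
    constructor
    · rintro ⟨P, rfl⟩ h x
      change (c P).1 _ = (c P).1 _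
      rw [hc, hc, chi_conj e]
    · intro hf
      obtain ⟨Pf, hPf⟩ := exists_eval_toInvolution e τ₁ τ₂ f
      obtain ⟨P, hP⟩ := exists_eval_blockChi_coeff h1 h2
        (isBlockInvariant_of_mem_invariants e τ₁ τ₂ hpq htr hf hPf)
      have hfP : ∀ x, f.1 x =
          MvPolynomial.eval (fun i : Fin (d * ν) => (chi d p q p' x).coeff i) P := fun x => by
        rw [hPf, hP _ (hmem x), hchi]
      -- For given `k`, take a point `x` whose `χ` has coefficients `σ⁻¹ (k i)`. Comparing `f (σ x)
      -- = σ (f x)` with the equivariance of `χ` shows that `P` and its conjugate by `σ` agree at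
      -- `k`.
      obtain ⟨Q, hQ⟩ := exists_map_eq_of_forall_map_eq (F := F) (P := P) fun σ => by
        refine MvPolynomial.funext fun k => ?_
        obtain ⟨x, hx⟩ := hsurj fun i => σ.symm (k i)
        have h3 := regularFunctions_galComponent f.2 σ x
        have h4 : (fun i : Fin (d * ν) => (chi d p q p' (galComponent σ x)).coeff i) = k := by
          funext i
          rw [chi_galComponent σ e, Polynomial.coeff_map]
          have := congrFun hx i
          rw [this]
          exact σ.apply_symm_apply _
        rw [hfP, hfP, h4, hx] at h3
        rw [h3, MvPolynomial.eval_map]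
        have h5 := MvPolynomial.eval₂_comp_left (σ : K →+* K) (RingHom.id K)
          (fun i => σ.symm (k i)) P
        refine Eq.trans ?_ h5.symm
        simp [Function.comp_def]
      refine ⟨Q, Subtype.ext (funext fun x => ?_)⟩
      change (c Q).1 x = _
      rw [hc, hQ, hfP]
  refine ⟨c, fun i x => ?_, ⟨fun r => hrange ▸ ⟨r, rfl⟩, fun B _ _ φ hφ => ?_⟩, hinj, hrange⟩
  · rw [hc, MvPolynomial.map_X, MvPolynomial.eval_X]
  · have hφ' : ∀ b, φ b ∈ c.range := fun b => hrange ▸ hφ b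
    -- An invariant morphism has comorphism with values in `c.range`, on which the injective map `c`
    -- can be inverted.
    refine ⟨((AlgEquiv.ofInjective c hinj).symm : c.range →ₐ[F] _).comp (φ.codRestrict _ hφ'),
      ?_, fun ψ hψ => ?_⟩
    · refine AlgHom.ext fun b => ?_
      exact congrArg Subtype.val
        ((AlgEquiv.ofInjective c hinj).apply_symm_apply ⟨φ b, hφ' b⟩)
    · refine AlgHom.ext fun b => hinj ?_
      have e1 : c (ψ b) = φ b := DFunLike.congr_fun hψ b
      rw [e1]
      exact (congrArg Subtype.val
        ((AlgEquiv.ofInjective c hinj).apply_symm_apply ⟨φ b, hφ' b⟩)).symm
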